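/- Let $M$ models and a covariate dimension $d$ be fixed. For a stacked parameter $\beta=(\beta_{01},\dots,\beta_{0M},\beta_1^\top,\dots,\beta_M^\top)^\top\in\mathbb R^{M+Md}$ the utility of model $i$ at a prompt covariate $x\in\mathbb R^d$ is $\theta_i(x)=\beta_{0i}+x^\top\beta_i$. For an ordered pair $a=(i,j)$ and $x\in\mathbb R^d$ the design vector is $\tilde x_a(x)=(e_j,e_j\otimes x)-(e_i,e_i\otimes x)$, so that $\beta^\top\tilde x_{(i,j)}(x)=\theta_j(x)-\theta_i(x)$. Let $\Theta=\{\beta:\sum_i\beta_{0i}=0,\ \sum_i\beta_i=0\}=\{\beta : C\beta=0\}$, let $\mathcal P=I-C^\top(CC^\top)^{-1}C$ be the orthogonal projection onto $\Theta$, let $\sigma(z)=(1+e^{-z})^{-1}$, and let $A^\dagger$ be the Moore–Penrose pseudoinverse of $A$. Data. Let $x_1,x_2,\dots\in\mathbb R^d$ be fixed prompt covariates. Let $(a_l,y_l)$, $l\ge 1$, be independent, where the pair $a_l=(i,j)$ of distinct models equals $a$ with probability $p_a$ (not depending on $l$), and where, given $a_l=(i,j)$, $y_l\in\{0,1\}$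 equals $1$ with probability $e^{\theta_j(x_l)}/(e^{\theta_j(x_l)}+e^{\theta_i(x_l)})$ for linear utilities $\theta_i$ as above (contextual Bradley–Terry–Luce model). Write $\tilde x_{a,l}=\tilde x_a(x_l)$ and $$\ell_L(\beta)=-\sum_{l=1}^L\big[y_l\log\sigma(\beta^\top\tilde x_{a_l,l})+(1-y_l)\log(1-\sigma(\beta^\top\tilde x_{a_l,l}))\big].$$ The true parameter $\tilde\beta^*\in\Theta$ is a minimizer of $\mathbb E[\ell_L]$ over $\Theta$ for every $L$. The constrained maximum likelihood estimator $\hat\beta=\hat\beta_L$ is a random vector which minimizes $\ell_L$ over $\Theta$ whenever a minimizer exists (and is arbitrary otherwise). Assumptions. (1) The graph on $[M]$ whose edges are the pairs observed with positive probability is connected. (2) Almost surely, for all large $L$, the matrix $\bar X$ with rows $(e_j\otimes x_l-e_i\otimes x_l)^\top$, $a_l=(i,j)$, $l\le L$, has full column rank up to common shifts of the $\beta_i$, that is, rank $(M-1)d$. (3) $\|\tilde x_{a,l}\|_2$ and $|\tilde\beta^{*\top}\tilde x_{a,l}|$ are bounded uniformly in $l$ and in the pairs $a$ with $p_a>0$.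 (4) With $\mathcal I_L(\beta)=\sum_{l=1}^L\sum_a p_a\,\sigma(\beta^\top\tilde x_{a,l})(1-\sigma(\beta^\top\tilde x_{a,l}))\,\tilde x_{a,l}\tilde x_{a,l}^\top$, one has $\frac1L\mathcal I_L(\tilde\beta^*)\to\bar{\mathcal I}$ as $L\to\infty$, where $\bar{\mathcal I}$ is positive definite on $\Theta$. Conclusion. Let $S$ be any set of ordered pairs of models and $x\in\mathbb R^d$ a fixed prompt covariate. Let $\tilde X_S$ be the matrix with rows $\tilde x_{(i,j)}(x)^\top$, $(i,j)\in S$, and put $\Delta_S(x)=\tilde X_S\tilde\beta^*$ and $\hat\Delta_S(x)=\tilde X_S\hat\beta_L$. Then $\tilde X_S(\mathcal P\bar{\mathcal I}\mathcal P)^\dagger\tilde X_S^\top$ is positive semidefinite, and as $L\to\infty$ $$\sqrt L\,\bigl(\hat\Delta_S(x)-\Delta_S(x)\bigr)\ \xrightarrow{d}\ \mathcal N\!\left(0,\ \tilde X_S(\mathcal P\bar{\mathcal I}\mathcal P)^\dagger\tilde X_S^\top\right).$$ -/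

import Mathlib

open MeasureTheory ProbabilityTheory Filter Topology
open scoped Matrix

noncomputable section

namespace ContextualBTL

/-! ### Moore-Penrose pseudoinverse of a real matrix -/

/-- The four Penrose equations: `G` is a Moore-Penrose pseudoinverse of the real matrix `A`. -/
structure IsMoorePenrose {m n : Type*} [Fintype m] [Fintype n]
    (A : Matrix m n ℝ) (G : Matrix n m ℝ) : Prop where
  mul_mul_self : A * G * A = A
  self_mul_mul : G * A * G = G
  symm_left : (A * G)ᵀ = A * G
  symm_right : (G * A)ᵀ = G * A

theorem IsMoorePenrose.unique {m n : Type*} [Fintype m] [Fintype n]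
    {A : Matrix m n ℝ} {G H : Matrix n m ℝ}
    (hG : IsMoorePenrose A G) (hH : IsMoorePenrose A H) : G = H := by
  have e1 : A * G = A * H := by
    calc A * G = (A * G)ᵀ := hG.symm_left.symm
      _ = ((A * H) * (A * G))ᵀ := by rw [← Matrix.mul_assoc, hH.mul_mul_self]
      _ = (A * G) * (A * H) := by rw [Matrix.transpose_mul, hG.symm_left, hH.symm_left]
      _ = A * H := by rw [← Matrix.mul_assoc, hG.mul_mul_self]
  have e2 : G * A = H * A := by
    calc G * A = (G * A)ᵀ := hG.symm_right.symm
      _ = ((G * A) * (H * A))ᵀ := by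
          rw [Matrix.mul_assoc, ← Matrix.mul_assoc A, hH.mul_mul_self]
      _ = (H * A) * (G * A) := by rw [Matrix.transpose_mul, hG.symm_right, hH.symm_right]
      _ = H * A := by rw [Matrix.mul_assoc, ← Matrix.mul_assoc A, hG.mul_mul_self]
  calc G = G * A * G := hG.self_mul_mul.symm
    _ = H * (A * G) := by rw [e2, Matrix.mul_assoc]
    _ = H * A * H := by rw [e1, Matrix.mul_assoc]
    _ = H := hH.self_mul_mul

theorem exists_isMoorePenrose {m n : Type*} [Fintype m] [Fintype n] (A : Matrix m n ℝ) :
    ∃ G : Matrix n m ℝ, IsMoorePenrose A G := by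
  classical
  set H : Matrix n n ℝ := Aᵀ * A with hHdef
  have hH : IsSelfAdjoint H := by
    change Hᴴ = H
    simp [hHdef, Matrix.conjTranspose_eq_transpose_of_trivial]
  have hc : ∀ f : ℝ → ℝ, ContinuousOn f (spectrum ℝ H) := fun f =>
    (Matrix.finite_real_spectrum (A := H)).continuousOn f
  set K : Matrix n n ℝ := cfc (fun x : ℝ => x⁻¹) H with hKdef
  have hid : cfc (fun x : ℝ => x) H = H := cfc_id' ℝ H
  have hHK : H * K = cfc (fun x : ℝ => x * x⁻¹) H := by
    rw [cfc_mul _ _ H (hc _) (hc _), hid]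
  have hKH : K * H = cfc (fun x : ℝ => x * x⁻¹) H := by
    have : (fun x : ℝ => x * x⁻¹) = fun x => x⁻¹ * x := by funext x; ring
    rw [this, cfc_mul _ _ H (hc _) (hc _), hid]
  have hHKH : H * K * H = H := by
    have e : (fun x : ℝ => (x * x⁻¹) * x) = fun x => x := by
      funext x; by_cases hx : x = 0 <;> simp [hx]
    have h := cfc_mul (fun x : ℝ => x * x⁻¹) (fun x : ℝ => x) H (hc _) (hc _)
    rw [e, hid, ← hHK] at h
    exact h.symm
  have hKHK : K * H * K = K := by
    have e : (fun x : ℝ => (x * x⁻¹) * x⁻¹) = fun x => x⁻¹ := by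
      funext x; by_cases hx : x = 0 <;> simp [hx]
    have h := cfc_mul (fun x : ℝ => x * x⁻¹) (fun x : ℝ => x⁻¹) H (hc _) (hc _)
    rw [e, ← hKdef, ← hKH] at h
    exact h.symm
  have hKt : Kᵀ = K := by
    have h : Kᴴ = K := (cfc_predicate (fun x : ℝ => x⁻¹) H : IsSelfAdjoint K)
    rwa [Matrix.conjTranspose_eq_transpose_of_trivial] at h
  have hHt : Hᵀ = H := by simp [hHdef]
  have hAKH : A * (K * H) = A := by
    have h0 : (A * (K * H) - A)ᴴ * (A * (K * H) - A) = 0 := by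
      have e : A * (K * H) - A = A * (K * H - 1) := by
        rw [Matrix.mul_sub, Matrix.mul_one]
      rw [Matrix.conjTranspose_eq_transpose_of_trivial, e, Matrix.transpose_mul,
        Matrix.mul_assoc, ← Matrix.mul_assoc Aᵀ, ← hHdef, Matrix.mul_sub H, Matrix.mul_one,
        ← Matrix.mul_assoc H, hHKH, sub_self, Matrix.mul_zero]
    exact sub_eq_zero.mp (Matrix.conjTranspose_mul_self_eq_zero.mp h0)
  refine ⟨K * Aᵀ, ⟨?_, ?_, ?_, ?_⟩⟩
  · rw [Matrix.mul_assoc, Matrix.mul_assoc, ← hHdef, hAKH]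
  · rw [Matrix.mul_assoc K, ← hHdef, ← Matrix.mul_assoc, hKHK]
  · simp [Matrix.transpose_mul, hKt, Matrix.mul_assoc]
  · rw [Matrix.mul_assoc, ← hHdef, Matrix.transpose_mul, hKt, hHt, hHK, hKH]

/-- The Moore-Penrose pseudoinverse `A†`. -/
def pinv {m n : Type*} [Fintype m] [Fintype n] (A : Matrix m n ℝ) : Matrix n m ℝ :=
  (exists_isMoorePenrose A).choose

theorem isMoorePenrose_pinv {m n : Type*} [Fintype m] [Fintype n] (A : Matrix m n ℝ) :
    IsMoorePenrose A (pinv A) :=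
  (exists_isMoorePenrose A).choose_spec

/-! ### Parameters, utilities, design vectors -/

/-- Coordinates of the stacked parameter `(β₀₁, …, β₀_M, β₁ᵀ, …, β_Mᵀ)`: the coordinate `inl i` is
the intercept `β₀ᵢ`, the coordinate `inr (i, k)` is the `k`-th entry of `βᵢ ∈ ℝ^d`. -/
abbrev Coord (M d : ℕ) : Type := Fin M ⊕ (Fin M × Fin d)

/-- The parameter space `ℝ^(M + M d)` with its Euclidean norm. -/
abbrev Param (M d : ℕ) : Type := EuclideanSpace ℝ (Coord M d)

/-- The utility `θᵢ(x) = β₀ᵢ + xᵀ βᵢ` of model `i` at the prompt covariate `x`. -/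
def utility {M d : ℕ} (β : Param M d) (i : Fin M) (x : EuclideanSpace ℝ (Fin d)) : ℝ :=
  β (Sum.inl i) + ∑ k, x k * β (Sum.inr (i, k))

/-- The stacked vector `(eᵢ, eᵢ ⊗ x)`. -/
def lift {M d : ℕ} (i : Fin M) (x : EuclideanSpace ℝ (Fin d)) : Param M d :=
  WithLp.toLp 2 (Sum.elim (fun m => if m = i then 1 else 0)
    (fun mk => if mk.1 = i then x mk.2 else 0))

/-- The design vector `x̃ = (eⱼ, eⱼ ⊗ x) - (eᵢ, eᵢ ⊗ x)` of the pair `q = (i, j)`. -/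
def design {M d : ℕ} (q : Fin M × Fin M) (x : EuclideanSpace ℝ (Fin d)) : Param M d :=
  lift q.2 x - lift q.1 x

/-- The matrix `X̃_S` whose rows are the design vectors of the pairs in `S` at the prompt `x`. -/
def designMatrix {M d : ℕ} (S : Finset (Fin M × Fin M)) (x : EuclideanSpace ℝ (Fin d)) :
    Matrix S (Coord M d) ℝ :=
  Matrix.of fun q c => design q.1 x c

/-- The vector `X̃_S β` of utility differences of the pairs in `S` at the prompt `x`. -/
def utilityDiff {M d : ℕ} (S : Finset (Fin M × Fin M)) (x : EuclideanSpace ℝ (Fin d))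
    (β : Param M d) : EuclideanSpace ℝ S :=
  WithLp.toLp 2 (designMatrix S x *ᵥ β.ofLp)

/-! ### Normalization constraints and the projection -/

/-- The constraint matrix `C`: one row for `∑ᵢ β₀ᵢ = 0`, and `d` rows for `∑ᵢ βᵢ = 0`. -/
def constraintMatrix (M d : ℕ) : Matrix (Unit ⊕ Fin d) (Coord M d) ℝ :=
  Matrix.fromBlocks (Matrix.of fun _ _ => 1) 0 0
    (Matrix.of fun k ik => if ik.2 = k then 1 else 0)

/-- The constrained parameter space `Θ`: `∑ᵢ β₀ᵢ = 0` and `∑ᵢ βᵢ = 0`. -/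
def Theta (M d : ℕ) : Set (Param M d) :=
  {β | (∑ i, β (Sum.inl i) = 0) ∧ ∀ k, ∑ i, β (Sum.inr (i, k)) = 0}

theorem mem_Theta_iff {M d : ℕ} (β : Param M d) :
    β ∈ Theta M d ↔ constraintMatrix M d *ᵥ β.ofLp = 0 := by
  have h1 : (constraintMatrix M d *ᵥ β.ofLp) (Sum.inl ()) = ∑ i, β (Sum.inl i) := by
    simp [constraintMatrix, Matrix.mulVec, dotProduct]
  have h2 : ∀ k, (constraintMatrix M d *ᵥ β.ofLp) (Sum.inr k) = ∑ i, β (Sum.inr (i, k)) := by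
    intro k
    simp [constraintMatrix, Matrix.mulVec, dotProduct, Fintype.sum_prod_type]
  constructor
  · rintro ⟨ha, hb⟩
    funext c
    rcases c with c | k
    · exact h1.trans ha
    · exact (h2 k).trans (hb k)
  · intro h
    exact ⟨by rw [← h1, h]; rfl, fun k => by rw [← h2, h]; rfl⟩

/-- The projection matrix `𝒫 = I - Cᵀ (C Cᵀ)⁻¹ C`. -/
def proj (M d : ℕ) : Matrix (Coord M d) (Coord M d) ℝ :=
  1 - (constraintMatrix M d)ᵀ * (constraintMatrix M d * (constraintMatrix M d)ᵀ)⁻¹ *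
    constraintMatrix M d

/-! ### Likelihood, Fisher information -/

/-- The numerical value in `{0, 1}` of a binary outcome. -/
def outcome (y : Bool) : ℝ := if y then 1 else 0

/-- The negative log-likelihood of the first `L` comparisons: the pairs are `a l`, the prompt
covariates `x l` and the outcomes `y l`, for `l < L`. -/
def negLogLik {M d : ℕ} (L : ℕ) (x : ℕ → EuclideanSpace ℝ (Fin d)) (a : ℕ → Fin M × Fin M)
    (y : ℕ → Bool) (β : Param M d) : ℝ :=
  ∑ l ∈ Finset.range L,
    -(outcome (y l) * Real.log (Real.sigmoid (inner ℝ β (design (a l) (x l))))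
      + (1 - outcome (y l)) * Real.log (1 - Real.sigmoid (inner ℝ β (design (a l) (x l)))))

/-- `β` is a minimizer over `Θ` of the function `f`. -/
def IsThetaArgmin {M d : ℕ} (f : Param M d → ℝ) (β : Param M d) : Prop :=
  β ∈ Theta M d ∧ IsMinOn f (Theta M d) β

/-- The Fisher information
`I_L(β) = ∑_{l < L} ∑_a p_a σ(βᵀ x̃_{a,l}) (1 - σ(βᵀ x̃_{a,l})) x̃_{a,l} x̃_{a,l}ᵀ`;
pairs that are not edges of the comparison graph have `p_a = 0`. -/
def fisherInfo {M d : ℕ} (L : ℕ) (p : Fin M × Fin M → ℝ) (x : ℕ → EuclideanSpace ℝ (Fin d))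
    (β : Param M d) : Matrix (Coord M d) (Coord M d) ℝ :=
  ∑ l ∈ Finset.range L, ∑ q,
    (p q * (Real.sigmoid (inner ℝ β (design q (x l)))
        * (1 - Real.sigmoid (inner ℝ β (design q (x l)))))) •
      Matrix.vecMulVec (design q (x l)).ofLp (design q (x l)).ofLp

/-- The matrix `X̄` with rows `x̄_l = eⱼ ⊗ x_l - eᵢ ⊗ x_l`, `a l = (i, j)`, for `l < L`. -/
def covariateMatrix {M d : ℕ} (L : ℕ) (x : ℕ → EuclideanSpace ℝ (Fin d))
    (a : ℕ → Fin M × Fin M) : Matrix (Fin L) (Fin M × Fin d) ℝ :=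
  Matrix.of fun l mk => design (a l) (x l) (Sum.inr mk)

/-! ### The sampling model and the assumptions -/

/-- Contextual Bradley-Terry-Luce sampling with utilities `θᵢ(x) = utility b i x`. The prompt
covariates `x l` are fixed; the comparisons `(a l, y l)` are independent; the pair `a l` of distinct
models is drawn with probabilities `p`; and, given `a l = (i, j)`, model `j` is preferred with
probability `exp θⱼ(x l) / (exp θⱼ(x l) + exp θᵢ(x l))`. -/
structure IsBTLSample {M d : ℕ} {Ω : Type*} [MeasurableSpace Ω] (P : Measure Ω)
    (p : Fin M × Fin M → ℝ) (b : Param M d) (x : ℕ → EuclideanSpace ℝ (Fin d))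
    (a : ℕ → Ω → Fin M × Fin M) (y : ℕ → Ω → Bool) : Prop where
  measurable_pair : ∀ l, Measurable (a l)
  measurable_outcome : ∀ l, Measurable (y l)
  indep : iIndepFun (fun l ω => (a l ω, y l ω)) P
  ne_of_pos : ∀ q, 0 < p q → q.1 ≠ q.2
  prob_pair : ∀ l q, P.real {ω | a l ω = q} = p q
  prob_outcome : ∀ l q, P.real {ω | a l ω = q ∧ y l ω = true} =
    p q * (Real.exp (utility b q.2 (x l)) /
      (Real.exp (utility b q.2 (x l)) + Real.exp (utility b q.1 (x l))))

/-- The comparison graph: `i` and `j` are adjacent if the pair is observed, in one order or the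
other, with positive probability. -/
def comparisonGraph {M : ℕ} (p : Fin M × Fin M → ℝ) : SimpleGraph (Fin M) :=
  SimpleGraph.fromRel fun i j => 0 < p (i, j)

/-- Covariate richness: almost surely, once `L` is large, `X̄` has the largest column rank that it
can have. The `d` vectors `1_M ⊗ e_k` are in the kernel of `X̄` for every data set, so that this
rank is `M d - d`. -/
def CovariateRichness {M d : ℕ} {Ω : Type*} [MeasurableSpace Ω] (P : Measure Ω)
    (x : ℕ → EuclideanSpace ℝ (Fin d)) (a : ℕ → Ω → Fin M × Fin M) : Prop :=
  ∀ᵐ ω ∂P, ∀ᶠ L in atTop, (covariateMatrix L x (fun l => a l ω)).rank = (M - 1) * d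

/-- Boundedness of the design vectors and of the utility differences, uniformly over the comparisons
that can be observed. -/
def Boundedness {M d : ℕ} (p : Fin M × Fin M → ℝ) (x : ℕ → EuclideanSpace ℝ (Fin d))
    (β : Param M d) : Prop :=
  (∃ B : ℝ, ∀ l q, 0 < p q → ‖(design q (x l) : Param M d)‖ < B) ∧
    ∃ B : ℝ, ∀ l q, 0 < p q → |inner ℝ β (design q (x l))| ≤ B

/-- The normalized Fisher information at `β` converges to `I`, and `I` is positive definite
on `Θ`. -/
def FisherLimit {M d : ℕ} (p : Fin M × Fin M → ℝ) (x : ℕ → EuclideanSpace ℝ (Fin d))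
    (β : Param M d) (I : Matrix (Coord M d) (Coord M d) ℝ) : Prop :=
  Tendsto (fun L : ℕ => (L : ℝ)⁻¹ • fisherInfo L p x β) atTop (𝓝 I) ∧
    ∀ v ∈ Theta M d, v ≠ 0 → 0 < v.ofLp ⬝ᵥ I *ᵥ v.ofLp

/-- The true parameter: for every sample size it minimizes the expected negative log-likelihood
over `Θ`. -/
def IsTrueParam {M d : ℕ} {Ω : Type*} [MeasurableSpace Ω] (P : Measure Ω)
    (x : ℕ → EuclideanSpace ℝ (Fin d)) (a : ℕ → Ω → Fin M × Fin M) (y : ℕ → Ω → Bool)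
    (β : Param M d) : Prop :=
  ∀ L, IsThetaArgmin
    (fun β' => ∫ ω, negLogLik L x (fun l => a l ω) (fun l => y l ω) β' ∂P) β

/-- Constrained maximum likelihood estimators `β̂_L`: random vectors that minimize the negative
log-likelihood over `Θ` for every data set for which a minimizer exists. For each `L` there are data
sets of positive probability for which none exists, and there `β̂_L` may take any value. -/
def IsConstrainedMLE {M d : ℕ} {Ω : Type*} [MeasurableSpace Ω] (P : Measure Ω)
    (x : ℕ → EuclideanSpace ℝ (Fin d)) (a : ℕ → Ω → Fin M × Fin M) (y : ℕ → Ω → Bool)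
    (βhat : ℕ → Ω → Param M d) : Prop :=
  ∀ L, AEMeasurable (βhat L) P ∧ ∀ᵐ ω ∂P,
    (∃ β, IsThetaArgmin (negLogLik L x (fun l => a l ω) (fun l => y l ω)) β) →
      IsThetaArgmin (negLogLik L x (fun l => a l ω) (fun l => y l ω)) (βhat L ω)

end ContextualBTL

end

noncomputable section

namespace ContextualBTL

/-! ### Limit theorems for bounded independent variables -/

/-! The proof is the convexity argument for M-estimators. Put `s = √L (β - β*)`, let `W` be the
score at `β*` divided by `√L`, and let `A` be the limiting Fisher information. The negative
log-likelihood, centred at `β*`, equals `-⟨s, W⟩ + sᵀ A s / 2` up to an error that is small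
uniformly on bounded sets of `s`, with probability tending to one (`abs_negLogLik_taylor_le`, and
Chebyshev bounds for the score and the Hessian). On `Θ` this quadratic is strongly convex with
minimizer `g = A† W`, so on the sphere of radius `δ` around `g` it exceeds its minimum by a fixed
multiple of `δ²`, which beats the error. A convex function that is larger on a sphere than at its
centre has a minimizer, and all its minimizers lie in the ball. Hence `√L (β̂ - β*) = A† W +
o_P(1)`; existence of the estimator and its consistency come out of the same step.

The score terms are independent, bounded and centred, and their covariances sum to the Fisher
information. A central limit theorem proved by characteristic functions gives `W` the limit
covariance `A`, and `A† A A† = A†` reduces the sandwich covariance to `A†`. Two facts connect this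
with the statement. Design vectors lie in `Θ`, so that `𝒫 A 𝒫 = A`. By strictness of the
cross-entropy inequality, `β*` has the same observable utility differences as the sampling
parameter. -/

lemma norm_prod_sub_prod_le {ι : Type*} (s : Finset ι) (z w : ι → ℂ)
    (hz : ∀ i ∈ s, ‖z i‖ ≤ 1) (hw : ∀ i ∈ s, ‖w i‖ ≤ 1) :
    ‖∏ i ∈ s, z i - ∏ i ∈ s, w i‖ ≤ ∑ i ∈ s, ‖z i - w i‖ := by
  classical
  induction s using Finset.induction_on with
  | empty => simp
  | insert i s hi ih =>
    rw [Finset.prod_insert hi, Finset.prod_insert hi, Finset.sum_insert hi]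
    have h1 : z i * ∏ j ∈ s, z j - w i * ∏ j ∈ s, w j
        = (z i - w i) * ∏ j ∈ s, z j + w i * (∏ j ∈ s, z j - ∏ j ∈ s, w j) := by ring
    have h2 : ‖∏ j ∈ s, z j‖ ≤ 1 := by
      rw [norm_prod]
      exact Finset.prod_le_one (fun _ _ => norm_nonneg _)
        fun j hj => hz j (Finset.mem_insert_of_mem hj)
    have h3 := ih (fun j hj => hz j (Finset.mem_insert_of_mem hj))
      (fun j hj => hw j (Finset.mem_insert_of_mem hj))
    rw [h1]
    refine (norm_add_le _ _).trans (add_le_add ?_ ?_)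
    · rw [norm_mul]
      exact mul_le_of_le_one_right (norm_nonneg _) h2
    · rw [norm_mul]
      exact (mul_le_of_le_one_left (norm_nonneg _) (hw i (Finset.mem_insert_self _ _))).trans h3

lemma norm_exp_mul_I_sub_taylor_le {x : ℝ} (hx : |x| ≤ 1) :
    ‖Complex.exp (x * Complex.I) - (1 + x * Complex.I - x ^ 2 / 2)‖ ≤ |x| ^ 3 := by
  have hn : ‖(x * Complex.I : ℂ)‖ = |x| := by simp
  have h := Complex.exp_bound (x := x * Complex.I) (by rw [hn]; exact hx) (n := 3) (by norm_num)
  rw [hn] at h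
  have e : ∑ m ∈ Finset.range 3, (x * Complex.I : ℂ) ^ m / (m.factorial : ℂ)
      = 1 + x * Complex.I - x ^ 2 / 2 := by
    simp [Finset.sum_range_succ, mul_pow]
    ring
  rw [e] at h
  refine h.trans ?_
  have : 0 ≤ |x| ^ 3 := by positivity
  norm_num [Nat.factorial]
  linarith

section

variable {Ω : Type*} [MeasurableSpace Ω] {P : Measure Ω} [IsProbabilityMeasure P]

/-- Both the characteristic function and the Gaussian one are within `(|s| C)³` of the common
expansion `1 - s² v / 2`. -/
lemma norm_charFun_map_sub_le {ξ : Ω → ℝ} (hξ : AEMeasurable ξ P) {C : ℝ}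
    (hC : ∀ᵐ ω ∂P, |ξ ω| ≤ C) (h0 : ∫ ω, ξ ω ∂P = 0) {s : ℝ} (hs : |s| * C ≤ 1) :
    ‖charFun (P.map ξ) s - (Real.exp (-(s ^ 2 * (∫ ω, ξ ω ^ 2 ∂P) / 2)) : ℝ)‖
      ≤ 2 * (|s| * C) ^ 3 := by
  set v := ∫ ω, ξ ω ^ 2 ∂P with hv
  have hC0 : 0 ≤ C := by
    obtain ⟨ω, hω⟩ := hC.exists
    exact (abs_nonneg _).trans hω
  have hsC : 0 ≤ |s| * C := by positivity
  have hb : MemLp ξ ⊤ P := memLp_top_of_bound hξ.aestronglyMeasurable C hC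
  have hi1 : Integrable ξ P := hb.integrable (by simp)
  have hi2 : Integrable (fun ω => ξ ω ^ 2) P :=
    (hb.mono_exponent (by simp : (2 : ENNReal) ≤ ⊤)).integrable_sq
  have hv0 : 0 ≤ v := integral_nonneg fun _ => sq_nonneg _
  have hv1 : v ≤ C ^ 2 := by
    have : v ≤ ∫ _, C ^ 2 ∂P := by
      refine integral_mono_ae hi2 (integrable_const _) ?_
      filter_upwards [hC] with ω hω
      exact sq_le_sq' (by linarith [neg_abs_le (ξ ω)]) ((le_abs_self _).trans hω)
    simpa using this
  have hT : charFun (P.map ξ) s - (1 - s ^ 2 * v / 2 : ℝ)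
      = ∫ ω, (Complex.exp ((s * ξ ω : ℝ) * Complex.I)
          - (1 + (s * ξ ω : ℝ) * Complex.I - (s * ξ ω : ℝ) ^ 2 / 2)) ∂P := by
    have i1 : Integrable (fun ω => Complex.exp ((s * ξ ω : ℝ) * Complex.I)) P := by
      refine Integrable.of_bound (C := 1) ?_ (Eventually.of_forall fun ω => ?_)
      · have : AEMeasurable (fun ω => Complex.exp ((s * ξ ω : ℝ) * Complex.I)) P := by fun_prop
        exact this.aestronglyMeasurable
      · rw [Complex.norm_exp_ofReal_mul_I]
    have i2 : Integrable (fun ω => ((s * ξ ω : ℝ) : ℂ) * Complex.I) P :=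
      ((hi1.const_mul s).ofReal).mul_const _
    have i3 : Integrable (fun ω => ((s * ξ ω : ℝ) : ℂ) ^ 2 / 2) P := by
      have : Integrable (fun ω => (((s ^ 2 * ξ ω ^ 2 : ℝ)) : ℂ) / 2) P :=
        ((hi2.const_mul (s ^ 2)).ofReal).div_const 2
      refine this.congr (Eventually.of_forall fun ω => ?_)
      push_cast
      ring
    have i12 : Integrable (fun ω => 1 + ((s * ξ ω : ℝ) : ℂ) * Complex.I) P :=
      (integrable_const _).add i2
    have i123 : Integrable
        (fun ω => 1 + ((s * ξ ω : ℝ) : ℂ) * Complex.I - ((s * ξ ω : ℝ) : ℂ) ^ 2 / 2) P :=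
      i12.sub i3
    rw [integral_sub i1 i123, integral_sub i12 i3, integral_add (integrable_const _) i2,
      charFun_apply_real, integral_map hξ (by fun_prop)]
    congr 1
    · congr 1
      funext ω
      push_cast
      ring_nf
    · rw [integral_mul_const, integral_complex_ofReal, integral_const_mul, h0]
      have : ∀ ω, (((s * ξ ω : ℝ)) : ℂ) ^ 2 / 2 = ((s ^ 2 / 2 * ξ ω ^ 2 : ℝ) : ℂ) := by
        intro ω
        push_cast
        ring
      simp_rw [this]
      rw [integral_complex_ofReal, integral_const_mul, ← hv]
      simp
      ring
  have hT' : ‖charFun (P.map ξ) s - (1 - s ^ 2 * v / 2 : ℝ)‖ ≤ (|s| * C) ^ 3 := by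
    rw [hT]
    have := norm_integral_le_of_norm_le_const (μ := P) (C := (|s| * C) ^ 3)
      (f := fun ω => Complex.exp ((s * ξ ω : ℝ) * Complex.I)
          - (1 + (s * ξ ω : ℝ) * Complex.I - (s * ξ ω : ℝ) ^ 2 / 2)) (by
        filter_upwards [hC] with ω hω
        have h1 : |s * ξ ω| ≤ |s| * C := by
          rw [abs_mul]
          exact mul_le_mul_of_nonneg_left hω (abs_nonneg _)
        exact (norm_exp_mul_I_sub_taylor_le (h1.trans hs)).trans
          (pow_le_pow_left₀ (abs_nonneg _) h1 3))
    simpa using this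
  have hu : s ^ 2 * v / 2 ≤ (|s| * C) ^ 2 := by
    rw [mul_pow, sq_abs]
    have : s ^ 2 * v ≤ s ^ 2 * C ^ 2 := mul_le_mul_of_nonneg_left hv1 (sq_nonneg _)
    have : 0 ≤ s ^ 2 * v := by positivity
    linarith
  have hu0 : 0 ≤ s ^ 2 * v / 2 := by positivity
  have hu1 : s ^ 2 * v / 2 ≤ 1 := hu.trans (pow_le_one₀ hsC hs)
  have hE : ‖((1 - s ^ 2 * v / 2 : ℝ) : ℂ) - (Real.exp (-(s ^ 2 * v / 2)) : ℝ)‖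
      ≤ (|s| * C) ^ 3 := by
    rw [← Complex.ofReal_sub, Complex.norm_real, norm_sub_rev]
    have h := Real.norm_exp_sub_one_sub_id_le (x := -(s ^ 2 * v / 2))
      (by rw [Real.norm_eq_abs, abs_neg, abs_of_nonneg hu0]; exact hu1)
    have e : Real.exp (-(s ^ 2 * v / 2)) - (1 - s ^ 2 * v / 2)
      = Real.exp (-(s ^ 2 * v / 2)) - 1 - -(s ^ 2 * v / 2) := by ring
    rw [e]
    refine h.trans ?_
    rw [norm_neg, Real.norm_eq_abs, abs_of_nonneg hu0]
    calc (s ^ 2 * v / 2) ^ 2 ≤ ((|s| * C) ^ 2) ^ 2 := pow_le_pow_left₀ hu0 hu 2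
      _ = (|s| * C) ^ 3 * (|s| * C) := by ring
      _ ≤ (|s| * C) ^ 3 := mul_le_of_le_one_right (by positivity) hs
  calc _ ≤ ‖charFun (P.map ξ) s - (1 - s ^ 2 * v / 2 : ℝ)‖
        + ‖((1 - s ^ 2 * v / 2 : ℝ) : ℂ) - (Real.exp (-(s ^ 2 * v / 2)) : ℝ)‖ :=
      norm_sub_le_norm_sub_add_norm_sub _ _ _
    _ ≤ _ := by linarith

/-- Each factor is replaced by the Gaussian characteristic function of the same variance. The
product error is at most the sum of `L` errors of order `L^(-3/2)`, hence of order `L^(-1/2)`. The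
Gaussian product depends on the variances only through their average, so the individual variances
need not converge. -/
lemma tendsto_charFun_normalized_sum {ξ : ℕ → Ω → ℝ} (hξ : ∀ l, AEMeasurable (ξ l) P)
    (hind : iIndepFun ξ P) {C : ℝ} (hC : ∀ l, ∀ᵐ ω ∂P, |ξ l ω| ≤ C)
    (h0 : ∀ l, ∫ ω, ξ l ω ∂P = 0) {v : ℝ}
    (hv : Tendsto (fun L : ℕ => (L : ℝ)⁻¹ * ∑ l ∈ Finset.range L, ∫ ω, ξ l ω ^ 2 ∂P) atTop (𝓝 v))
    (t : ℝ) :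
    Tendsto (fun L : ℕ => charFun (P.map fun ω => (√(L : ℝ))⁻¹ * ∑ l ∈ Finset.range L, ξ l ω) t)
      atTop (𝓝 ((Real.exp (-(t ^ 2 * v / 2)) : ℝ) : ℂ)) := by
  have hsq : Tendsto (fun L : ℕ => (√(L : ℝ))⁻¹) atTop (𝓝 0) :=
    tendsto_inv_atTop_zero.comp (Real.tendsto_sqrt_atTop.comp tendsto_natCast_atTop_atTop)
  set w : ℕ → ℕ → ℝ := fun L l => Real.exp (-(((√(L : ℝ))⁻¹ * t) ^ 2 * (∫ ω, ξ l ω ^ 2 ∂P) / 2))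
    with hw
  have hlim : Tendsto (fun L : ℕ => ((∏ l ∈ Finset.range L, w L l : ℝ) : ℂ)) atTop
      (𝓝 ((Real.exp (-(t ^ 2 * v / 2)) : ℝ) : ℂ)) := by
    refine (Complex.continuous_ofReal.tendsto _).comp ?_
    have e : ∀ L : ℕ, ∏ l ∈ Finset.range L, w L l
        = Real.exp (-(t ^ 2 * ((L : ℝ)⁻¹ * ∑ l ∈ Finset.range L, ∫ ω, ξ l ω ^ 2 ∂P) / 2)) := by
      intro L
      rw [hw, ← Real.exp_sum]
      congr 1
      have : ((√(L : ℝ))⁻¹) ^ 2 = (L : ℝ)⁻¹ := by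
        rw [inv_pow, Real.sq_sqrt (Nat.cast_nonneg L)]
      rw [Finset.sum_neg_distrib, ← Finset.sum_div, ← Finset.mul_sum, mul_pow, this]
      ring
    simp_rw [e]
    exact (Real.continuous_exp.tendsto _).comp (((hv.const_mul _).div_const 2).neg)
  have hdiff : Tendsto (fun L : ℕ =>
      charFun (P.map fun ω => (√(L : ℝ))⁻¹ * ∑ l ∈ Finset.range L, ξ l ω) t
        - ((∏ l ∈ Finset.range L, w L l : ℝ) : ℂ)) atTop (𝓝 0) := by
    have hb : Tendsto (fun L : ℕ => 2 * (|t| * C) ^ 3 * (√(L : ℝ))⁻¹) atTop (𝓝 0) := by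
      simpa using hsq.const_mul (2 * (|t| * C) ^ 3)
    refine squeeze_zero_norm' ?_ hb
    have hsm : ∀ᶠ L : ℕ in atTop, (√(L : ℝ))⁻¹ * (|t| * C) ≤ 1 := by
      have : Tendsto (fun L : ℕ => (√(L : ℝ))⁻¹ * (|t| * C)) atTop (𝓝 0) := by
        simpa using hsq.mul_const (|t| * C)
      exact this.eventually_le_const (by norm_num)
    filter_upwards [hsm, eventually_gt_atTop 0] with L hL hL0
    have hr : 0 ≤ (√(L : ℝ))⁻¹ := by positivity
    rw [charFun_map_mul_comp (Finset.aemeasurable_fun_sum _ fun l _ => hξ l),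
      (hind.restrict _).charFun_map_fun_finsetSum_eq_prod (fun l _ => hξ l), Finset.prod_apply,
      Complex.ofReal_prod]
    have : ∀ l, IsProbabilityMeasure (P.map (ξ l)) := fun l =>
      Measure.isProbabilityMeasure_map (hξ l)
    refine (norm_prod_sub_prod_le _ _ _ (fun l _ => norm_charFun_le_one _) fun l _ => ?_).trans ?_
    · rw [Complex.norm_real, Real.norm_eq_abs, Real.abs_exp, Real.exp_le_one_iff, neg_nonpos]
      have : 0 ≤ ∫ ω, ξ l ω ^ 2 ∂P := integral_nonneg fun _ => sq_nonneg _
      positivity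
    · have h1 : |(√(L : ℝ))⁻¹ * t| * C = (√(L : ℝ))⁻¹ * (|t| * C) := by
        rw [abs_mul, abs_of_nonneg hr, mul_assoc]
      refine (Finset.sum_le_sum fun l _ => norm_charFun_map_sub_le (hξ l) (hC l) (h0 l)
        (s := (√(L : ℝ))⁻¹ * t) (h1.trans_le hL)).trans ?_
      rw [h1, Finset.sum_const, Finset.card_range, nsmul_eq_mul]
      have hsL : √(L : ℝ) ^ 2 = L := Real.sq_sqrt (Nat.cast_nonneg L)
      have hs0 : 0 < √(L : ℝ) := Real.sqrt_pos.2 (by exact_mod_cast hL0)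
      rw [← hsL, Real.sqrt_sq hs0.le]
      apply le_of_eq
      field_simp
  simpa using hdiff.add hlim

/-- Central limit theorem for bounded independent centred vectors, not identically distributed. -/
theorem tendstoInDistribution_normalized_sum {E : Type*} [NormedAddCommGroup E]
    [InnerProductSpace ℝ E] [FiniteDimensional ℝ E] [MeasurableSpace E] [BorelSpace E]
    {ξ : ℕ → Ω → E} (hξ : ∀ l, Measurable (ξ l))
    (hind : iIndepFun ξ P) {C : ℝ} (hC : ∀ l, ∀ᵐ ω ∂P, ‖ξ l ω‖ ≤ C)
    (h0 : ∀ l t, ∫ ω, inner ℝ (ξ l ω) t ∂P = 0) {v : E → ℝ}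
    (hv : ∀ t, Tendsto (fun L : ℕ => (L : ℝ)⁻¹ * ∑ l ∈ Finset.range L,
      ∫ ω, inner ℝ (ξ l ω) t ^ 2 ∂P) atTop (𝓝 (v t)))
    (μ : Measure E) [IsProbabilityMeasure μ]
    (hμ : ∀ t, charFun μ t = (Real.exp (-(v t / 2)) : ℝ)) :
    TendstoInDistribution (fun (L : ℕ) ω => (√(L : ℝ))⁻¹ • ∑ l ∈ Finset.range L, ξ l ω) atTop
      (id : E → E) (fun _ => P) μ where
  forall_aemeasurable L :=
    (Finset.aemeasurable_fun_sum _ fun l _ => (hξ l).aemeasurable).const_smul _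
  aemeasurable_limit := aemeasurable_id
  tendsto := by
    refine ProbabilityMeasure.tendsto_iff_tendsto_charFun.2 fun t => ?_
    have hm : ∀ L : ℕ, AEMeasurable (fun ω => (√(L : ℝ))⁻¹ • ∑ l ∈ Finset.range L, ξ l ω) P :=
      fun L => (Finset.aemeasurable_fun_sum _ fun l _ => (hξ l).aemeasurable).const_smul _
    -- Cramér–Wold reduction: the characteristic function of the vector sum at `t` is that of its
    -- projection on `t`, taken at `1`.
    have h := tendsto_charFun_normalized_sum (P := P) (ξ := fun l ω => inner ℝ (ξ l ω) t)
      (fun l => ((hξ l).inner measurable_const).aemeasurable)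
      (hind.comp (fun _ z => inner ℝ z t) fun _ => by fun_prop) (C := C * ‖t‖)
      (fun l => by
        filter_upwards [hC l] with ω hω
        exact (abs_real_inner_le_norm _ _).trans
          (mul_le_mul_of_nonneg_right hω (norm_nonneg _)))
      (fun l => h0 l t) (hv t) 1
    have e : ∀ L : ℕ, charFun (P.map fun ω => (√(L : ℝ))⁻¹ • ∑ l ∈ Finset.range L, ξ l ω) t
        = charFun (P.map fun ω => (√(L : ℝ))⁻¹ * ∑ l ∈ Finset.range L, inner ℝ (ξ l ω) t) 1 := by
      intro L
      rw [charFun_apply, charFun_apply_real, integral_map (hm L) (by fun_prop), integral_map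
        (by
          refine AEMeasurable.const_mul (Finset.aemeasurable_fun_sum _ fun l _ => ?_) _
          exact ((hξ l).inner measurable_const).aemeasurable) (by fun_prop)]
      congr 1
      funext ω
      rw [real_inner_smul_left, sum_inner]
      simp
    simp only [ProbabilityMeasure.coe_mk, Measure.map_id]
    simp_rw [e, hμ]
    simpa using h

/-- Chebyshev's inequality for a sum of bounded independent variables. -/
lemma measure_abs_sum_sub_integral_ge_le {ξ : ℕ → Ω → ℝ} (hξ : ∀ l, AEMeasurable (ξ l) P)
    (hind : iIndepFun ξ P) {C : ℝ} (hC : ∀ l, ∀ᵐ ω ∂P, |ξ l ω| ≤ C) (L : ℕ) {t : ℝ} (ht : 0 < t) :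
    P {ω | t ≤ |∑ l ∈ Finset.range L, ξ l ω - ∑ l ∈ Finset.range L, ∫ ω, ξ l ω ∂P|}
      ≤ ENNReal.ofReal (L * C ^ 2 / t ^ 2) := by
  have hb : ∀ l, MemLp (ξ l) ⊤ P := fun l =>
    memLp_top_of_bound (hξ l).aestronglyMeasurable C (hC l)
  have hb2 : ∀ l, MemLp (ξ l) 2 P := fun l => (hb l).mono_exponent le_top
  have hs : MemLp (∑ l ∈ Finset.range L, ξ l) 2 P := memLp_finsetSum' _ fun l _ => hb2 l
  have h := meas_ge_le_variance_div_sq hs ht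
  have hint : ∫ ω, ∑ l ∈ Finset.range L, ξ l ω ∂P = ∑ l ∈ Finset.range L, ∫ ω, ξ l ω ∂P :=
    integral_finsetSum _ fun l _ => (hb l).integrable le_top
  simp only [Finset.sum_apply, hint] at h
  refine h.trans (ENNReal.ofReal_le_ofReal ?_)
  refine div_le_div_of_nonneg_right ?_ (sq_nonneg _)
  rw [IndepFun.variance_sum (fun l _ => hb2 l) fun i _ j _ hij => hind.indepFun hij]
  have : ∀ l, variance (ξ l) P ≤ C ^ 2 := by
    intro l
    refine (variance_le_expectation_sq (hξ l).aestronglyMeasurable).trans ?_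
    have : ∫ ω, (ξ l ^ 2) ω ∂P ≤ ∫ _, C ^ 2 ∂P := by
      refine integral_mono_ae (hb2 l).integrable_sq (integrable_const _) ?_
      filter_upwards [hC l] with ω hω
      exact sq_le_sq' (by linarith [neg_abs_le (ξ l ω)]) ((le_abs_self _).trans hω)
    simpa using this
  calc _ ≤ ∑ l ∈ Finset.range L, C ^ 2 := Finset.sum_le_sum fun l _ => this l
    _ = _ := by simp

end

/-! ### The logistic loss -/

/-- The softplus function `log (1 + e^t)`, the primitive of the sigmoid. -/
def softplus (t : ℝ) : ℝ := Real.log (1 + Real.exp t)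

lemma hasDerivAt_softplus (t : ℝ) : HasDerivAt softplus (Real.sigmoid t) t := by
  have h := ((Real.hasDerivAt_exp t).const_add 1).log (by positivity)
  convert! h using 1
  rw [Real.sigmoid_def, Real.exp_neg]
  have := Real.exp_pos t
  field_simp
  ring

lemma log_one_sub_sigmoid (t : ℝ) : Real.log (1 - Real.sigmoid t) = -softplus t := by
  rw [← Real.sigmoid_neg, Real.sigmoid_def, neg_neg, Real.log_inv, softplus]

lemma log_sigmoid (t : ℝ) : Real.log (Real.sigmoid t) = t - softplus t := by
  have h := Real.sigmoid_mul_rexp_neg t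
  have h2 := congrArg Real.log h
  rw [Real.log_mul (Real.sigmoid_pos t).ne' (Real.exp_pos _).ne', Real.log_exp, Real.sigmoid_neg,
    log_one_sub_sigmoid] at h2
  linarith

lemma logistic_loss_eq (o t : ℝ) :
    -(o * Real.log (Real.sigmoid t) + (1 - o) * Real.log (1 - Real.sigmoid t))
      = softplus t - o * t := by
  rw [log_sigmoid, log_one_sub_sigmoid]
  ring

lemma continuous_softplus : Continuous softplus :=
  continuous_iff_continuousAt.2 fun t => (hasDerivAt_softplus t).continuousAt

lemma convexOn_softplus : ConvexOn ℝ Set.univ softplus := by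
  have hd : deriv softplus = Real.sigmoid := funext fun t => (hasDerivAt_softplus t).deriv
  refine MonotoneOn.convexOn_of_deriv convex_univ continuous_softplus.continuousOn
    (fun t _ => (hasDerivAt_softplus t).differentiableAt.differentiableWithinAt) ?_
  rw [hd]
  exact Real.sigmoid_monotone.monotoneOn _

/-- The cross entropy of a Bernoulli variable with log-odds `s` is minimal at `s` only. -/
lemma cross_entropy_lt {s t : ℝ} (hst : t ≠ s) :
    softplus s - Real.sigmoid s * s < softplus t - Real.sigmoid s * t := by
  -- By the mean value theorem the increment of `softplus` is `σ(c) (t - s)` with `c` strictly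
  -- between `s` and `t`; strict monotonicity of `σ` gives the sign of `(σ(c) - σ(s)) (t - s)`.
  rcases lt_or_gt_of_ne hst with h | h
  · obtain ⟨c, hc, hc'⟩ := exists_hasDerivAt_eq_slope softplus Real.sigmoid h
      continuous_softplus.continuousOn fun u _ => hasDerivAt_softplus u
    rw [eq_div_iff (by linarith)] at hc'
    have := Real.sigmoid_lt hc.2
    nlinarith [hc.1, hc.2]
  · obtain ⟨c, hc, hc'⟩ := exists_hasDerivAt_eq_slope softplus Real.sigmoid h
      continuous_softplus.continuousOn fun u _ => hasDerivAt_softplus u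
    rw [eq_div_iff (by linarith)] at hc'
    have := Real.sigmoid_lt hc.1
    nlinarith [hc.1, hc.2]

lemma abs_sub_le_of_hasDerivAt {G G' : ℝ → ℝ} (hG : ∀ u, HasDerivAt G (G' u) u) {K h : ℝ}
    (hK : ∀ u, |u| ≤ |h| → |G' u| ≤ K) : |G h - G 0| ≤ K * |h| := by
  have hs : Convex ℝ (Metric.closedBall (0 : ℝ) |h|) := convex_closedBall _ _
  have := hs.norm_image_sub_le_of_norm_hasDerivWithin_le (f := G) (f' := G') (C := K)
    (x := 0) (y := h) (fun u _ => (hG u).hasDerivWithinAt)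
    (fun u hu => hK u (by simpa using hu)) (by simp) (by simp)
  simpa using this

/-- The variance `σ (1 - σ)` of a Bernoulli variable with given log-odds. -/
def logisticVar (t : ℝ) : ℝ := Real.sigmoid t * (1 - Real.sigmoid t)

lemma logisticVar_nonneg (t : ℝ) : 0 ≤ logisticVar t :=
  mul_nonneg (Real.sigmoid_nonneg t) (sub_nonneg.2 (Real.sigmoid_le_one t))

lemma logisticVar_le_one (t : ℝ) : logisticVar t ≤ 1 :=
  mul_le_one₀ (Real.sigmoid_le_one t) (sub_nonneg.2 (Real.sigmoid_le_one t))
    (by linarith [Real.sigmoid_nonneg t])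

lemma hasDerivAt_logisticVar (t : ℝ) :
    HasDerivAt logisticVar (logisticVar t * (1 - 2 * Real.sigmoid t)) t := by
  have h := (Real.hasDerivAt_sigmoid t).mul ((Real.hasDerivAt_sigmoid t).const_sub 1)
  convert! h using 1
  rw [logisticVar]
  ring

lemma abs_logisticVar_sub_le (t h : ℝ) : |logisticVar (t + h) - logisticVar t| ≤ |h| := by
  have := abs_sub_le_of_hasDerivAt (G := fun u => logisticVar (t + u)) (h := h) (K := 1)
    (fun u => (hasDerivAt_logisticVar (t + u)).comp_const_add t u) fun u _ => by
      rw [abs_mul, abs_of_nonneg (logisticVar_nonneg _)]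
      refine mul_le_one₀ (logisticVar_le_one _) (abs_nonneg _) (abs_le.2 ⟨?_, ?_⟩)
      · linarith [Real.sigmoid_le_one (t + u)]
      · linarith [Real.sigmoid_nonneg (t + u)]
  simpa using this

/-- The Lipschitz bound for the second derivative is carried up by applying the mean value
inequality twice. The constant is crude but valid for all `t` and `h`, so linear predictors need no
localization. -/
lemma abs_softplus_taylor_le (t h : ℝ) :
    |softplus (t + h) - softplus t - Real.sigmoid t * h - logisticVar t * h ^ 2 / 2| ≤ |h| ^ 3 := by
  have h1 : ∀ h, |Real.sigmoid (t + h) - Real.sigmoid t - logisticVar t * h| ≤ |h| ^ 2 := by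
    intro h
    have := abs_sub_le_of_hasDerivAt
      (G := fun u => Real.sigmoid (t + u) - Real.sigmoid t - logisticVar t * u) (h := h) (K := |h|)
      (G' := fun u => logisticVar (t + u) - logisticVar t)
      (fun u => by
        have := ((((Real.hasDerivAt_sigmoid (t + u)).comp_const_add t u).sub_const
          (Real.sigmoid t)).sub ((hasDerivAt_id u).const_mul (logisticVar t)))
        convert! this using 1
        simp [logisticVar])
      fun u hu => (abs_logisticVar_sub_le t u).trans hu
    simpa [sq] using this
  have := abs_sub_le_of_hasDerivAt
    (G := fun u => softplus (t + u) - softplus t - Real.sigmoid t * u - logisticVar t * u ^ 2 / 2)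
    (G' := fun u => Real.sigmoid (t + u) - Real.sigmoid t - logisticVar t * u) (h := h)
    (K := |h| ^ 2)
    (fun u => by
      have := ((((hasDerivAt_softplus (t + u)).comp_const_add t u).sub_const
        (softplus t)).sub ((hasDerivAt_id u).const_mul (Real.sigmoid t))).sub
        ((((hasDerivAt_id u).pow 2).const_mul (logisticVar t)).div_const 2)
      convert! this using 1
      simp
      ring)
    fun u hu => (h1 u).trans (pow_le_pow_left₀ (abs_nonneg _) hu 2)
  simpa [pow_succ] using this

/-! ### Minimizers of convex functions -/

/-- A convex function on a convex closed set that exceeds `f c` on the sphere of radius `r`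
around `c` has a minimizer, and all minimizers lie in the ball. -/
lemma exists_isMinOn_and_forall_dist_le {E : Type*} [NormedAddCommGroup E] [NormedSpace ℝ E]
    [FiniteDimensional ℝ E] {V : Set E} (hVc : IsClosed V) {f : E → ℝ} (hf : ConvexOn ℝ V f)
    (hfc : Continuous f) {c : E} (hc : c ∈ V) {r : ℝ} (hr : 0 < r)
    (hsph : ∀ s ∈ V, ‖s - c‖ = r → f c < f s) :
    (∃ β ∈ V, IsMinOn f V β) ∧ ∀ β ∈ V, IsMinOn f V β → ‖β - c‖ ≤ r := by
  -- The segment from `c` to a point outside the ball crosses the sphere. If `f s ≤ f c`, convexity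
  -- would give `f ≤ f c` at the crossing point.
  have hout : ∀ s ∈ V, r < ‖s - c‖ → f c < f s := by
    intro s hs hrs
    have hpos : 0 < ‖s - c‖ := hr.trans hrs
    set θ := r / ‖s - c‖ with hθ
    have hθ0 : 0 < θ := by positivity
    have hθ1 : θ < 1 := (div_lt_one hpos).2 hrs
    have hmem := hf.1 hc hs (sub_nonneg.2 hθ1.le) hθ0.le (by ring)
    have hle := hf.2 hc hs (sub_nonneg.2 hθ1.le) hθ0.le (by ring)
    have hn : ‖(1 - θ) • c + θ • s - c‖ = r := by
      have : (1 - θ) • c + θ • s - c = θ • (s - c) := by module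
      rw [this, norm_smul, Real.norm_of_nonneg hθ0.le, hθ]
      field_simp
    have hlt := hsph _ hmem hn
    simp only [smul_eq_mul] at hle
    nlinarith
  constructor
  · have hK : IsCompact (V ∩ Metric.closedBall c r) :=
      (isCompact_closedBall c r).inter_left hVc
    obtain ⟨β, hβ, hmin⟩ := hK.exists_isMinOn ⟨c, hc, by simp [hr.le]⟩ hfc.continuousOn
    refine ⟨β, hβ.1, fun s hs => ?_⟩
    by_cases hsr : ‖s - c‖ ≤ r
    · exact hmin ⟨hs, by simpa [dist_eq_norm] using hsr⟩
    · have h1 : f β ≤ f c := hmin ⟨hc, by simp [hr.le]⟩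
      exact h1.trans (hout s hs (not_le.1 hsr)).le
  · intro β hβ hmin
    by_contra hcon
    exact absurd (hmin hc) (not_le.2 (hout β hβ (not_le.1 hcon)))

/-! ### The constrained parameter space -/

lemma inner_eq_dotProduct {ι : Type*} [Fintype ι] (u v : EuclideanSpace ℝ ι) :
    inner ℝ u v = u.ofLp ⬝ᵥ v.ofLp := by
  simp [EuclideanSpace.inner_eq_star_dotProduct, dotProduct_comm]

/-- `Θ` as a linear subspace. -/
def thetaSubmodule (M d : ℕ) : Submodule ℝ (Param M d) where
  carrier := Theta M d
  zero_mem' := by simp [mem_Theta_iff]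
  add_mem' := by
    intro u v hu hv
    rw [mem_Theta_iff] at *
    simp [Matrix.mulVec_add, hu, hv]
  smul_mem' := by
    intro r u hu
    rw [mem_Theta_iff] at *
    simp [Matrix.mulVec_smul, hu]

lemma mem_thetaSubmodule {M d : ℕ} {β : Param M d} : β ∈ thetaSubmodule M d ↔ β ∈ Theta M d :=
  Iff.rfl

lemma isClosed_Theta (M d : ℕ) : IsClosed (Theta M d) :=
  (thetaSubmodule M d).closed_of_finiteDimensional

lemma convex_Theta (M d : ℕ) : Convex ℝ (Theta M d) :=
  (thetaSubmodule M d).convex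

lemma design_mem_Theta {M d : ℕ} (q : Fin M × Fin M) (x : EuclideanSpace ℝ (Fin d)) :
    design q x ∈ Theta M d := by
  constructor
  · simp [design, lift, Finset.sum_sub_distrib]
  · intro k
    simp [design, lift, Finset.sum_sub_distrib]

lemma inner_lift {M d : ℕ} (β : Param M d) (i : Fin M) (x : EuclideanSpace ℝ (Fin d)) :
    inner ℝ β (lift i x) = utility β i x := by
  rw [inner_eq_dotProduct]
  simp [dotProduct, lift, utility, Fintype.sum_sum_type, Fintype.sum_prod_type]
  simp [mul_comm]

lemma inner_design {M d : ℕ} (β : Param M d) (q : Fin M × Fin M)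
    (x : EuclideanSpace ℝ (Fin d)) :
    inner ℝ β (design q x) = utility β q.2 x - utility β q.1 x := by
  rw [design, inner_sub_right, inner_lift, inner_lift]

/-- Every parameter can be normalized to lie in `Θ` without changing utility differences. -/
lemma exists_mem_Theta_inner_design_eq {M d : ℕ} (b : Param M d) :
    ∃ b' ∈ Theta M d, ∀ q x, inner ℝ b' (design q x) = inner ℝ b (design q x) := by
  -- The orthogonal projection is self-adjoint and fixes design vectors, which already lie in `Θ`.
  refine ⟨(thetaSubmodule M d).starProjection b,
    mem_thetaSubmodule.1 (Submodule.starProjection_apply_mem _ _),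
    fun q x => ?_⟩
  rw [Submodule.inner_starProjection_left_eq_right,
    Submodule.starProjection_eq_self_iff.2 (mem_thetaSubmodule.2 (design_mem_Theta q x))]

/-! ### Symmetric matrices that act on `Θ` -/

section

variable {M d : ℕ} {A : Matrix (Coord M d) (Coord M d) ℝ}

/-- By symmetry, `C A = 0` also gives `A Cᵀ = 0`, so the correction term of `𝒫` vanishes on both
sides. It allows the proof to work with the pseudoinverse of the Fisher limit itself. -/
lemma proj_mul_mul_proj (hsymm : Aᵀ = A) (hA : constraintMatrix M d * A = 0) :
    proj M d * A * proj M d = A := by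
  have hA' : A * (constraintMatrix M d)ᵀ = 0 := by
    have := congrArg Matrix.transpose hA
    rwa [Matrix.transpose_mul, hsymm, Matrix.transpose_zero] at this
  have h1 : proj M d * A = A := by
    rw [proj, Matrix.sub_mul, Matrix.one_mul, Matrix.mul_assoc, hA, Matrix.mul_zero, sub_zero]
  have h2 : A * proj M d = A := by
    rw [proj, Matrix.mul_sub, Matrix.mul_one, ← Matrix.mul_assoc, ← Matrix.mul_assoc, hA',
      Matrix.zero_mul, Matrix.zero_mul, sub_zero]
  rw [h1, h2]

lemma transpose_pinv {n : Type*} [Fintype n] {A : Matrix n n ℝ} (hsymm : Aᵀ = A) :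
    (pinv A)ᵀ = pinv A := by
  have h := isMoorePenrose_pinv A
  refine IsMoorePenrose.unique (A := A) ⟨?_, ?_, ?_, ?_⟩ h
  · have := congrArg Matrix.transpose h.mul_mul_self
    simpa [Matrix.transpose_mul, hsymm, Matrix.mul_assoc] using this
  · have := congrArg Matrix.transpose h.self_mul_mul
    simpa [Matrix.transpose_mul, hsymm, Matrix.mul_assoc] using this
  · have := h.symm_right
    rw [Matrix.transpose_mul, hsymm] at this
    rw [this, h.symm_right]
  · have := h.symm_left
    rw [Matrix.transpose_mul, hsymm] at this
    rw [this, h.symm_left]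

/-- For symmetric `A` the pseudoinverse factors as `A (A†ᵀ A†)`, so its range lies in that of `A`.
-/
lemma constraintMatrix_mul_pinv (hsymm : Aᵀ = A) (hA : constraintMatrix M d * A = 0) :
    constraintMatrix M d * pinv A = 0 := by
  have h := isMoorePenrose_pinv A
  have e : A * ((pinv A)ᵀ * pinv A) = pinv A := by
    have := h.symm_right
    rw [Matrix.transpose_mul, hsymm] at this
    rw [← Matrix.mul_assoc, this, h.self_mul_mul]
  rw [← e, ← Matrix.mul_assoc, hA, Matrix.zero_mul]

lemma toLp_pinv_mulVec_mem_Theta (hsymm : Aᵀ = A) (hA : constraintMatrix M d * A = 0)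
    (w : Coord M d → ℝ) : (WithLp.toLp 2 (pinv A *ᵥ w) : Param M d) ∈ Theta M d := by
  rw [mem_Theta_iff]
  simp [Matrix.mulVec_mulVec, constraintMatrix_mul_pinv hsymm hA]

/-- The residual `A A† w - w` stays in `Θ` and is killed by `A`, because `A` commutes with `A†`;
positive definiteness on `Θ` forces it to be zero. This makes `A† W` an exact stationary point of
the limiting quadratic. -/
lemma mulVec_pinv_mulVec (hsymm : Aᵀ = A) (hA : constraintMatrix M d * A = 0)
    (hpos : ∀ v ∈ Theta M d, v ≠ 0 → 0 < v.ofLp ⬝ᵥ A *ᵥ v.ofLp) {w : Param M d}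
    (hw : w ∈ Theta M d) : A *ᵥ (pinv A *ᵥ w.ofLp) = w.ofLp := by
  have h := isMoorePenrose_pinv A
  have hcomm : A * pinv A = pinv A * A := by
    have := h.symm_left
    rwa [Matrix.transpose_mul, hsymm, transpose_pinv hsymm, eq_comm] at this
  rw [mem_Theta_iff] at hw
  by_contra hne
  set r : Param M d := WithLp.toLp 2 (A *ᵥ (pinv A *ᵥ w.ofLp) - w.ofLp) with hr
  have hr0 : r ≠ 0 := by
    intro h0
    have := congrArg WithLp.ofLp h0
    exact hne (sub_eq_zero.1 (by simpa [hr] using this))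
  have hrT : r ∈ Theta M d := by
    rw [mem_Theta_iff, hr]
    simp [Matrix.mulVec_sub, Matrix.mulVec_mulVec, hw, ← Matrix.mul_assoc, hA]
  have hAr : A *ᵥ r.ofLp = 0 := by
    rw [hr]
    simp only [Matrix.mulVec_sub, Matrix.mulVec_mulVec]
    rw [hcomm, ← Matrix.mul_assoc, h.mul_mul_self, sub_self]
  have := hpos r hrT hr0
  rw [hAr] at this
  simp at this

lemma exists_quadratic_lower_bound
    (hpos : ∀ v ∈ Theta M d, v ≠ 0 → 0 < v.ofLp ⬝ᵥ A *ᵥ v.ofLp) :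
    ∃ m > 0, ∀ v ∈ Theta M d, m * ‖v‖ ^ 2 ≤ v.ofLp ⬝ᵥ A *ᵥ v.ofLp := by
  have hcont : Continuous fun v : Param M d => v.ofLp ⬝ᵥ A *ᵥ v.ofLp := by
    unfold dotProduct Matrix.mulVec dotProduct
    fun_prop
  have hK : IsCompact (Theta M d ∩ Metric.sphere (0 : Param M d) 1) :=
    (isCompact_sphere 0 1).inter_left (isClosed_Theta M d)
  have hscale : ∀ v ∈ Theta M d, v ≠ 0 → ∃ u ∈ Theta M d ∩ Metric.sphere (0 : Param M d) 1,
      v = ‖v‖ • u := by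
    intro v hv h0
    have hn : ‖v‖ ≠ 0 := norm_ne_zero_iff.2 h0
    refine ⟨‖v‖⁻¹ • v, ⟨(thetaSubmodule M d).smul_mem _ hv, ?_⟩, ?_⟩
    · simp [norm_smul, hn]
    · rw [smul_smul, mul_inv_cancel₀ hn, one_smul]
  -- The unit sphere of `Θ` is empty when `Θ = 0`, for instance with a single model; any constant
  -- then works.
  rcases (Theta M d ∩ Metric.sphere (0 : Param M d) 1).eq_empty_or_nonempty with he | hne
  · refine ⟨1, one_pos, fun v hv => ?_⟩
    by_cases h0 : v = 0
    · simp [h0]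
    · obtain ⟨u, hu, -⟩ := hscale v hv h0
      rw [he] at hu
      exact hu.elim
  · obtain ⟨u, hu, hmin⟩ := hK.exists_isMinOn hne hcont.continuousOn
    refine ⟨u.ofLp ⬝ᵥ A *ᵥ u.ofLp, hpos u hu.1 ?_, fun v hv => ?_⟩
    · rintro rfl
      simpa using hu.2
    · by_cases h0 : v = 0
      · simp [h0]
      · obtain ⟨w, hw, hvw⟩ := hscale v hv h0
        have h1 : u.ofLp ⬝ᵥ A *ᵥ u.ofLp ≤ w.ofLp ⬝ᵥ A *ᵥ w.ofLp := hmin hw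
        have h2 : v.ofLp ⬝ᵥ A *ᵥ v.ofLp = ‖v‖ ^ 2 * (w.ofLp ⬝ᵥ A *ᵥ w.ofLp) := by
          conv_lhs => rw [hvw]
          simp only [WithLp.ofLp_smul, Matrix.mulVec_smul, dotProduct_smul, smul_dotProduct,
            smul_eq_mul]
          ring
        rw [h2, mul_comm]
        exact mul_le_mul_of_nonneg_left h1 (sq_nonneg _)

end

lemma quadratic_sub {n : Type*} [Fintype n] {A : Matrix n n ℝ} (hsymm : Aᵀ = A) (s c : n → ℝ) :
    (s - c) ⬝ᵥ A *ᵥ (s - c)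
      = s ⬝ᵥ A *ᵥ s - c ⬝ᵥ A *ᵥ c - 2 * ((s - c) ⬝ᵥ A *ᵥ c) := by
  have h : c ⬝ᵥ A *ᵥ s = s ⬝ᵥ A *ᵥ c := by
    rw [dotProduct_comm, ← Matrix.vecMul_transpose, hsymm, Matrix.dotProduct_mulVec]
  simp only [Matrix.mulVec_sub, dotProduct_sub, sub_dotProduct, h]
  ring

lemma abs_apply_le_norm {ι : Type*} [Fintype ι] (v : EuclideanSpace ℝ ι) (c : ι) :
    |v c| ≤ ‖v‖ := by
  simpa using PiLp.norm_apply_le v c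

lemma abs_quadratic_le {ι : Type*} [Fintype ι] {A : Matrix ι ι ℝ} {ε : ℝ}
    (hA : ∀ c c', |A c c'| ≤ ε) (s : EuclideanSpace ℝ ι) :
    |s.ofLp ⬝ᵥ A *ᵥ s.ofLp| ≤ (Fintype.card ι : ℝ) ^ 2 * ε * ‖s‖ ^ 2 := by
  have h : ∀ c c', |s c * (A c c' * s c')| ≤ ε * ‖s‖ ^ 2 := by
    intro c c'
    rw [abs_mul, abs_mul]
    have h1 := abs_apply_le_norm s c
    have h2 := abs_apply_le_norm s c'
    have hε : 0 ≤ ε := (abs_nonneg _).trans (hA c c')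
    calc |s c| * (|A c c'| * |s c'|) ≤ ‖s‖ * (ε * ‖s‖) := by
          gcongr
          exact hA c c'
      _ = ε * ‖s‖ ^ 2 := by ring
  simp only [dotProduct, Matrix.mulVec, Finset.mul_sum]
  calc _ ≤ ∑ c, |∑ c', s c * (A c c' * s c')| := Finset.abs_sum_le_sum_abs _ _
    _ ≤ ∑ c : ι, ∑ c' : ι, ε * ‖s‖ ^ 2 := Finset.sum_le_sum fun c _ =>
        (Finset.abs_sum_le_sum_abs _ _).trans (Finset.sum_le_sum fun c' _ => h c c')
    _ = _ := by
        simp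
        ring

/-! ### The likelihood of a data set -/

section

variable {M d : ℕ}

/-- The score at `β` of one comparison with pair `q`, covariate `x` and outcome `y`. -/
def score (β : Param M d) (q : Fin M × Fin M) (x : EuclideanSpace ℝ (Fin d)) (y : Bool) :
    Param M d :=
  (outcome y - Real.sigmoid (inner ℝ β (design q x))) • design q x

/-- The Hessian at `β` of the negative log-likelihood of one comparison. -/
def hessian (β : Param M d) (q : Fin M × Fin M) (x : EuclideanSpace ℝ (Fin d)) :
    Matrix (Coord M d) (Coord M d) ℝ :=
  logisticVar (inner ℝ β (design q x)) • Matrix.vecMulVec (design q x).ofLp (design q x).ofLp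

lemma vecMulVec_quadratic {ι : Type*} [Fintype ι] (u v : ι → ℝ) :
    v ⬝ᵥ Matrix.vecMulVec u u *ᵥ v = (v ⬝ᵥ u) ^ 2 := by
  rw [Matrix.vecMulVec_mulVec]
  simp [dotProduct_smul, dotProduct_comm u v, sq]

lemma hessian_quadratic (β v : Param M d) (q : Fin M × Fin M) (x : EuclideanSpace ℝ (Fin d)) :
    v.ofLp ⬝ᵥ hessian β q x *ᵥ v.ofLp
      = logisticVar (inner ℝ β (design q x)) * inner ℝ v (design q x) ^ 2 := by
  rw [hessian, Matrix.smul_mulVec, dotProduct_smul, vecMulVec_quadratic, inner_eq_dotProduct v,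
    smul_eq_mul]

lemma score_mem_Theta (β : Param M d) (q : Fin M × Fin M) (x : EuclideanSpace ℝ (Fin d))
    (y : Bool) : score β q x y ∈ Theta M d :=
  (thetaSubmodule M d).smul_mem _ (design_mem_Theta q x)

lemma negLogLik_eq (L : ℕ) (x : ℕ → EuclideanSpace ℝ (Fin d)) (a : ℕ → Fin M × Fin M)
    (y : ℕ → Bool) (β : Param M d) :
    negLogLik L x a y β = ∑ l ∈ Finset.range L,
      (softplus (inner ℝ β (design (a l) (x l)))
        - outcome (y l) * inner ℝ β (design (a l) (x l))) :=
  Finset.sum_congr rfl fun _ _ => logistic_loss_eq _ _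

lemma continuous_negLogLik (L : ℕ) (x : ℕ → EuclideanSpace ℝ (Fin d))
    (a : ℕ → Fin M × Fin M) (y : ℕ → Bool) : Continuous (negLogLik L x a y) := by
  simp_rw [funext (negLogLik_eq L x a y)]
  have := continuous_softplus
  fun_prop

lemma convexOn_negLogLik (L : ℕ) (x : ℕ → EuclideanSpace ℝ (Fin d))
    (a : ℕ → Fin M × Fin M) (y : ℕ → Bool) :
    ConvexOn ℝ (Theta M d) (negLogLik L x a y) := by
  refine ⟨convex_Theta M d, fun u _ v _ r s hr hs hrs => ?_⟩
  simp only [negLogLik_eq, smul_eq_mul, Finset.mul_sum]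
  rw [← Finset.sum_add_distrib]
  refine Finset.sum_le_sum fun l _ => ?_
  have := convexOn_softplus.2 (Set.mem_univ (inner ℝ u (design (a l) (x l))))
    (Set.mem_univ (inner ℝ v (design (a l) (x l)))) hr hs hrs
  simp only [smul_eq_mul] at this
  rw [inner_add_left, real_inner_smul_left, real_inner_smul_left]
  linarith

/-- The scalar expansion is summed over the comparisons. The linear term enters with a plus sign
because the score is minus the gradient of the loss; outcomes occur in that term only. -/
lemma abs_negLogLik_taylor_le (L : ℕ) (x : ℕ → EuclideanSpace ℝ (Fin d))
    (a : ℕ → Fin M × Fin M) (y : ℕ → Bool) (β v : Param M d) {B : ℝ}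
    (hB : ∀ l, ‖(design (a l) (x l) : Param M d)‖ ≤ B) :
    |negLogLik L x a y (β + v) - negLogLik L x a y β
        + inner ℝ v (∑ l ∈ Finset.range L, score β (a l) (x l) (y l))
        - v.ofLp ⬝ᵥ (∑ l ∈ Finset.range L, hessian β (a l) (x l)) *ᵥ v.ofLp / 2|
      ≤ L * (B * ‖v‖) ^ 3 := by
  have hq : v.ofLp ⬝ᵥ (∑ l ∈ Finset.range L, hessian β (a l) (x l)) *ᵥ v.ofLp
      = ∑ l ∈ Finset.range L, logisticVar (inner ℝ β (design (a l) (x l)))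
          * inner ℝ v (design (a l) (x l)) ^ 2 := by
    rw [Matrix.sum_mulVec, dotProduct_sum]
    exact Finset.sum_congr rfl fun l _ => hessian_quadratic _ _ _ _
  rw [hq, negLogLik_eq, negLogLik_eq, inner_sum, ← Finset.sum_sub_distrib,
    ← Finset.sum_add_distrib, Finset.sum_div, ← Finset.sum_sub_distrib]
  refine (Finset.abs_sum_le_sum_abs _ _).trans ?_
  have : ∀ l ∈ Finset.range L, |softplus (inner ℝ (β + v) (design (a l) (x l)))
        - outcome (y l) * inner ℝ (β + v) (design (a l) (x l))
        - (softplus (inner ℝ β (design (a l) (x l)))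
          - outcome (y l) * inner ℝ β (design (a l) (x l)))
        + inner ℝ v (score β (a l) (x l) (y l))
        - logisticVar (inner ℝ β (design (a l) (x l))) * inner ℝ v (design (a l) (x l)) ^ 2 / 2|
      ≤ (B * ‖v‖) ^ 3 := by
    intro l _
    have h := abs_softplus_taylor_le (inner ℝ β (design (a l) (x l)))
      (inner ℝ v (design (a l) (x l)))
    have hle : |inner ℝ v (design (a l) (x l))| ≤ B * ‖v‖ := by
      refine (abs_real_inner_le_norm _ _).trans ?_
      rw [mul_comm]
      exact mul_le_mul_of_nonneg_right (hB l) (norm_nonneg _)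
    refine le_trans (le_of_eq ?_) (h.trans (pow_le_pow_left₀ (abs_nonneg _) hle 3))
    rw [score, inner_add_left, real_inner_smul_right]
    congr 1
    ring
  refine (Finset.sum_le_sum this).trans ?_
  simp

/-- If the normalized Hessian is close to `A`, then the negative log-likelihood has a minimizer
over `Θ`, and every minimizer is close to the one-step approximation `β + g / √L`, where `A g` is
the normalized score. -/
lemma exists_thetaArgmin_and_forall_norm_sub_le {L : ℕ} (hL : 0 < L)
    (x : ℕ → EuclideanSpace ℝ (Fin d)) (a : ℕ → Fin M × Fin M) (y : ℕ → Bool) {β : Param M d}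
    (hβ : β ∈ Theta M d) {B : ℝ} (hB : ∀ l, ‖(design (a l) (x l) : Param M d)‖ ≤ B)
    {A : Matrix (Coord M d) (Coord M d) ℝ} (hsymm : Aᵀ = A) {m : ℝ}
    (hm : ∀ v ∈ Theta M d, m * ‖v‖ ^ 2 ≤ v.ofLp ⬝ᵥ A *ᵥ v.ofLp) {ε : ℝ}
    (hε : ∀ c c', |((L : ℝ)⁻¹ • ∑ l ∈ Finset.range L, hessian β (a l) (x l) - A) c c'| ≤ ε)
    {g : Param M d} (hg : g ∈ Theta M d)
    (hAg : A *ᵥ g.ofLp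
      = ((√(L : ℝ))⁻¹ • ∑ l ∈ Finset.range L, score β (a l) (x l) (y l)).ofLp)
    {R δ : ℝ} (hgR : ‖g‖ ≤ R) (hδ : 0 < δ)
    (hsmall : (Fintype.card (Coord M d) : ℝ) ^ 2 * ε * (R + δ) ^ 2 / 2
      + (B * (R + δ)) ^ 3 * (√(L : ℝ))⁻¹ < m * δ ^ 2 / 4) :
    (∃ β', IsThetaArgmin (negLogLik L x a y) β') ∧
      ∀ β', IsThetaArgmin (negLogLik L x a y) β' → ‖√(L : ℝ) • (β' - β) - g‖ ≤ δ := by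
  set r := √(L : ℝ) with hr
  have hr0 : 0 < r := Real.sqrt_pos.2 (by exact_mod_cast hL)
  have hr2 : r ^ 2 = L := Real.sq_sqrt (Nat.cast_nonneg L)
  have hLpos : (0 : ℝ) < L := by exact_mod_cast hL
  set f := negLogLik L x a y with hf
  set W : Param M d := r⁻¹ • ∑ l ∈ Finset.range L, score β (a l) (x l) (y l) with hW
  have hB0 : 0 ≤ B := (norm_nonneg _).trans (hB 0)
  have hR0 : 0 ≤ R := (norm_nonneg _).trans hgR
  set η := (Fintype.card (Coord M d) : ℝ) ^ 2 * ε * (R + δ) ^ 2 / 2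
      + (B * (R + δ)) ^ 3 * r⁻¹ with hη
  -- Uniform quadratic approximation on the ball of radius `R + δ`, which contains both `g` and the
  -- sphere of radius `δ` around it. The first part of `η` is the Hessian error; the second is the
  -- cubic remainder, `L · (1/√L)³ = 1/√L`.
  have happrox : ∀ s : Param M d, ‖s‖ ≤ R + δ →
      |f (β + r⁻¹ • s) - f β + inner ℝ s W - s.ofLp ⬝ᵥ A *ᵥ s.ofLp / 2| ≤ η := by
    intro s hs
    have h1 := abs_negLogLik_taylor_le L x a y β (r⁻¹ • s) hB
    have h2 := abs_quadratic_le hε s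
    have e1 : inner ℝ (r⁻¹ • s) (∑ l ∈ Finset.range L, score β (a l) (x l) (y l))
        = inner ℝ s W := by
      rw [hW, real_inner_smul_left, real_inner_smul_right]
    have e2 : (r⁻¹ • s).ofLp ⬝ᵥ (∑ l ∈ Finset.range L, hessian β (a l) (x l)) *ᵥ (r⁻¹ • s).ofLp
        = s.ofLp ⬝ᵥ ((L : ℝ)⁻¹ • ∑ l ∈ Finset.range L, hessian β (a l) (x l)) *ᵥ s.ofLp := by
      simp only [WithLp.ofLp_smul, Matrix.mulVec_smul, dotProduct_smul, smul_dotProduct,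
        smul_eq_mul, Matrix.smul_mulVec, ← hr2]
      field_simp
    rw [e1, e2] at h1
    rw [Matrix.sub_mulVec, dotProduct_sub] at h2
    have h3 : (L : ℝ) * (B * ‖r⁻¹ • s‖) ^ 3 ≤ (B * (R + δ)) ^ 3 * r⁻¹ := by
      have : (L : ℝ) * (B * ‖r⁻¹ • s‖) ^ 3 = (B * ‖s‖) ^ 3 * r⁻¹ := by
        rw [norm_smul, norm_inv, Real.norm_of_nonneg hr0.le, ← hr2]
        field_simp
      rw [this]
      gcongr
    have hε0 : (Fintype.card (Coord M d) : ℝ) ^ 2 * ε * ‖s‖ ^ 2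
        ≤ (Fintype.card (Coord M d) : ℝ) ^ 2 * ε * (R + δ) ^ 2 := by
      -- The sign of `ε` is read off from an entry bound, so the case without coordinates is
      -- separate; there the cardinality is zero.
      rcases isEmpty_or_nonempty (Coord M d) with h | ⟨⟨c⟩⟩
      · simp
      · have : 0 ≤ ε := (abs_nonneg _).trans (hε c c)
        gcongr
    rw [abs_le] at h1 h2 ⊢
    constructor <;> linarith [h1.1, h1.2, h2.1, h2.2]
  have hc : β + r⁻¹ • g ∈ Theta M d :=
    (thetaSubmodule M d).add_mem hβ ((thetaSubmodule M d).smul_mem _ hg)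
  have hrescale : ∀ β' : Param M d, β' = β + r⁻¹ • (r • (β' - β)) := by
    intro β'
    rw [smul_smul, inv_mul_cancel₀ hr0.ne', one_smul, add_sub_cancel]
  have hnorm : ∀ β' : Param M d, ‖r • (β' - β) - g‖ = r * ‖β' - (β + r⁻¹ • g)‖ := by
    intro β'
    have : r • (β' - β) - g = r • (β' - (β + r⁻¹ • g)) := by
      rw [← sub_sub, smul_sub r (β' - β), smul_smul, mul_inv_cancel₀ hr0.ne', one_smul]
    rw [this, norm_smul, Real.norm_of_nonneg hr0.le]
  -- Completing the square, the quadratic at `s` exceeds that at `g` by `(s - g)ᵀ A (s - g) / 2 ≥ m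
  -- δ² / 2`. The approximation is used twice and costs `2η`, hence the requirement `η < m δ² / 4`.
  have hsph : ∀ β' ∈ Theta M d, ‖β' - (β + r⁻¹ • g)‖ = δ / r → f (β + r⁻¹ • g) < f β' := by
    intro β' hβ' hdist
    set s := r • (β' - β) with hs
    have hsT : s ∈ Theta M d :=
      (thetaSubmodule M d).smul_mem _ ((thetaSubmodule M d).sub_mem hβ' hβ)
    have hsg : ‖s - g‖ = δ := by
      rw [hs, hnorm, hdist]
      field_simp
    have hsR : ‖s‖ ≤ R + δ := by
      calc ‖s‖ = ‖g + (s - g)‖ := by rw [add_sub_cancel]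
        _ ≤ _ := (norm_add_le _ _).trans (add_le_add hgR hsg.le)
    have h1 := happrox s hsR
    have h2 := happrox g (hgR.trans (by linarith))
    have h3 := hm (s - g) ((thetaSubmodule M d).sub_mem hsT hg)
    rw [WithLp.ofLp_sub, quadratic_sub hsymm, hsg, hAg] at h3
    have h4 : (s.ofLp - g.ofLp) ⬝ᵥ W.ofLp = inner ℝ s W - inner ℝ g W := by
      rw [inner_eq_dotProduct, inner_eq_dotProduct, sub_dotProduct]
    rw [h4] at h3
    have h5 : g.ofLp ⬝ᵥ A *ᵥ g.ofLp = g.ofLp ⬝ᵥ W.ofLp := by rw [hAg]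
    rw [hrescale β']
    change f (β + r⁻¹ • g) < f (β + r⁻¹ • s)
    rw [abs_le] at h1 h2
    linarith [h1.1, h2.2]
  have key := exists_isMinOn_and_forall_dist_le (isClosed_Theta M d) (convexOn_negLogLik L x a y)
    (continuous_negLogLik L x a y) hc (div_pos hδ hr0) hsph
  refine ⟨key.1, fun β' hβ' => ?_⟩
  rw [hnorm, mul_comm, ← le_div_iff₀ hr0]
  exact key.2 β' hβ'.1 hβ'.2

end

/-! ### Expectations under the sampling model -/

section

variable {M d : ℕ} {Ω : Type*} [MeasurableSpace Ω] {P : Measure Ω}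
  {p : Fin M × Fin M → ℝ} {b : Param M d} {x : ℕ → EuclideanSpace ℝ (Fin d)}
  {a : ℕ → Ω → Fin M × Fin M} {y : ℕ → Ω → Bool}

lemma exp_div_add_exp_eq_sigmoid (s t : ℝ) :
    Real.exp t / (Real.exp t + Real.exp s) = Real.sigmoid (t - s) := by
  rw [Real.sigmoid_def, neg_sub, Real.exp_sub]
  have := Real.exp_pos t
  have := Real.exp_pos s
  field_simp

lemma IsBTLSample.measurable_sample (h : IsBTLSample P p b x a y) (l : ℕ) :
    Measurable fun ω => (a l ω, y l ω) :=
  (h.measurable_pair l).prodMk (h.measurable_outcome l)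

lemma IsBTLSample.measurable_comp_sample {E : Type*} [MeasurableSpace E]
    (h : IsBTLSample P p b x a y) (l : ℕ) (F : Fin M × Fin M → Bool → E) :
    Measurable fun ω => F (a l ω) (y l ω) :=
  (measurable_of_countable fun z : (Fin M × Fin M) × Bool => F z.1 z.2).comp
    (h.measurable_sample l)

lemma IsBTLSample.iIndepFun_comp_sample {E : Type*} [MeasurableSpace E]
    (h : IsBTLSample P p b x a y) (F : ℕ → Fin M × Fin M → Bool → E) :
    iIndepFun (fun l ω => F l (a l ω) (y l ω)) P :=
  h.indep.comp (fun l z => F l z.1 z.2) fun _ => measurable_of_countable _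

lemma IsBTLSample.prob_nonneg (h : IsBTLSample P p b x a y) (q : Fin M × Fin M) : 0 ≤ p q := by
  rw [← h.prob_pair 0 q]
  exact measureReal_nonneg

variable [IsProbabilityMeasure P]

lemma IsBTLSample.ae_pos (h : IsBTLSample P p b x a y) : ∀ᵐ ω ∂P, ∀ l, 0 < p (a l ω) := by
  rw [ae_all_iff]
  intro l
  have : ∀ q, ∀ᵐ ω ∂P, a l ω = q → 0 < p q := by
    intro q
    rcases (h.prob_nonneg q).lt_or_eq with hq | hq
    · exact Eventually.of_forall fun _ _ => hq
    · have h0 := h.prob_pair l q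
      rw [← hq, measureReal_eq_zero_iff] at h0
      have : ∀ᵐ ω ∂P, ¬ a l ω = q := by
        rw [ae_iff]
        simpa using h0
      filter_upwards [this] with ω hω hω'
      exact absurd hω' hω
  filter_upwards [ae_all_iff.2 this] with ω hω
  exact hω _ rfl

lemma IsBTLSample.integral_comp_sample (h : IsBTLSample P p b x a y) (l : ℕ)
    (F : Fin M × Fin M → Bool → ℝ) :
    ∫ ω, F (a l ω) (y l ω) ∂P
      = ∑ q, p q * (Real.sigmoid (inner ℝ b (design q (x l))) * F q true
          + (1 - Real.sigmoid (inner ℝ b (design q (x l)))) * F q false) := by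
  have hm := h.measurable_sample l
  have : IsProbabilityMeasure (P.map fun ω => (a l ω, y l ω)) :=
    Measure.isProbabilityMeasure_map hm.aemeasurable
  have hF : Measurable fun z : (Fin M × Fin M) × Bool => F z.1 z.2 := measurable_of_countable _
  have e : ∫ ω, F (a l ω) (y l ω) ∂P
      = ∫ z, F z.1 z.2 ∂(P.map fun ω => (a l ω, y l ω)) :=
    (integral_map (φ := fun ω => (a l ω, y l ω)) hm.aemeasurable hF.aestronglyMeasurable).symm
  have htrue : ∀ q, (P.map fun ω => (a l ω, y l ω)).real {(q, true)}
      = p q * Real.sigmoid (inner ℝ b (design q (x l))) := by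
    intro q
    rw [map_measureReal_apply hm (measurableSet_singleton _), inner_design,
      ← exp_div_add_exp_eq_sigmoid, ← h.prob_outcome l q]
    congr 1
    ext ω
    simp
  have hfalse : ∀ q, (P.map fun ω => (a l ω, y l ω)).real {(q, false)}
      = p q * (1 - Real.sigmoid (inner ℝ b (design q (x l)))) := by
    intro q
    have hsum : P.real {ω | a l ω = q} = P.real {ω | a l ω = q ∧ y l ω = true}
        + P.real {ω | a l ω = q ∧ y l ω = false} := by
      have hms : MeasurableSet {ω | a l ω = q ∧ y l ω = false} := by
        have := hm (measurableSet_singleton (q, false))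
        convert! this using 1
        ext ω
        simp
      rw [← measureReal_union _ hms]
      · congr 1
        ext ω
        simp only [Set.mem_ofPred_eq, Set.mem_union]
        cases y l ω <;> simp
      · rw [Set.disjoint_left]
        rintro ω ⟨-, h1⟩ ⟨-, h2⟩
        rw [h1] at h2
        exact absurd h2 (by decide)
    rw [h.prob_pair, h.prob_outcome, exp_div_add_exp_eq_sigmoid, ← inner_design] at hsum
    rw [map_measureReal_apply hm (measurableSet_singleton _)]
    have : (fun ω => (a l ω, y l ω)) ⁻¹' {(q, false)} = {ω | a l ω = q ∧ y l ω = false} := by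
      ext ω
      simp
    rw [this]
    linarith
  rw [e, integral_fintype Integrable.of_finite, Fintype.sum_prod_type]
  refine Finset.sum_congr rfl fun q _ => ?_
  rw [Fintype.sum_bool, htrue, hfalse, smul_eq_mul, smul_eq_mul]
  ring

lemma IsBTLSample.integrable_comp_sample (h : IsBTLSample P p b x a y) (l : ℕ)
    (F : Fin M × Fin M → Bool → ℝ) : Integrable (fun ω => F (a l ω) (y l ω)) P := by
  have hF : Measurable fun z : (Fin M × Fin M) × Bool => F z.1 z.2 := measurable_of_countable _
  have hi : Integrable (fun z : (Fin M × Fin M) × Bool => F z.1 z.2)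
      (P.map fun ω => (a l ω, y l ω)) := by
    have : IsProbabilityMeasure (P.map fun ω => (a l ω, y l ω)) :=
      Measure.isProbabilityMeasure_map (h.measurable_sample l).aemeasurable
    exact Integrable.of_finite
  exact hi.comp_measurable (h.measurable_sample l)

lemma IsBTLSample.integral_negLogLik (h : IsBTLSample P p b x a y) (L : ℕ) (β : Param M d) :
    ∫ ω, negLogLik L x (fun l => a l ω) (fun l => y l ω) β ∂P
      = ∑ l ∈ Finset.range L, ∑ q, p q * (softplus (inner ℝ β (design q (x l)))
          - Real.sigmoid (inner ℝ b (design q (x l))) * inner ℝ β (design q (x l))) := by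
  simp_rw [negLogLik_eq]
  rw [integral_finsetSum _ fun l _ => h.integrable_comp_sample l fun q o =>
    softplus (inner ℝ β (design q (x l))) - outcome o * inner ℝ β (design q (x l))]
  refine Finset.sum_congr rfl fun l _ => ?_
  rw [h.integral_comp_sample l fun q o =>
    softplus (inner ℝ β (design q (x l))) - outcome o * inner ℝ β (design q (x l))]
  refine Finset.sum_congr rfl fun q _ => ?_
  simp only [outcome, if_true, Bool.false_eq_true, if_false]
  ring

/-- The true parameter gives the same utility differences as the parameter of the sampling model,
for all comparisons that can be observed. -/
lemma IsBTLSample.inner_eq_of_isTrueParam (h : IsBTLSample P p b x a y) {βstar : Param M d}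
    (htrue : IsTrueParam P x a y βstar) (l : ℕ) {q : Fin M × Fin M} (hq : 0 < p q) :
    inner ℝ βstar (design q (x l)) = inner ℝ b (design q (x l)) := by
  -- The sampling parameter `b` need not lie in `Θ`; its normalization `b'` is an admissible
  -- competitor that minimizes every term of the expected loss.
  obtain ⟨b', hb', hbb⟩ := exists_mem_Theta_inner_design_eq b
  -- Sample size `l + 1` is the first one that includes comparison `l`.
  have hmin := (htrue (l + 1)).2 hb'
  simp only [Set.mem_ofPred_eq, h.integral_negLogLik] at hmin
  by_contra hne
  refine absurd hmin (not_le.2 ?_)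
  have hle : ∀ k q', p q' * (softplus (inner ℝ b' (design q' (x k)))
        - Real.sigmoid (inner ℝ b (design q' (x k))) * inner ℝ b' (design q' (x k)))
      ≤ p q' * (softplus (inner ℝ βstar (design q' (x k)))
        - Real.sigmoid (inner ℝ b (design q' (x k))) * inner ℝ βstar (design q' (x k))) := by
    intro k q'
    refine mul_le_mul_of_nonneg_left ?_ (h.prob_nonneg q')
    rw [hbb]
    by_cases he : inner ℝ βstar (design q' (x k)) = inner ℝ b (design q' (x k))
    · rw [he]
    · exact (cross_entropy_lt he).le
  refine Finset.sum_lt_sum (fun k _ => Finset.sum_le_sum fun q' _ => hle k q')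
    ⟨l, Finset.self_mem_range_succ l, ?_⟩
  refine Finset.sum_lt_sum (fun q' _ => hle l q') ⟨q, Finset.mem_univ q, ?_⟩
  rw [hbb]
  exact mul_lt_mul_of_pos_left (cross_entropy_lt hne) hq

/-- Pairs of probability zero contribute nothing, and on the others `b` and `βstar` have the same
log-odds. -/
lemma IsBTLSample.integral_comp_sample' (h : IsBTLSample P p b x a y) {βstar : Param M d}
    (htrue : IsTrueParam P x a y βstar) (l : ℕ) (F : Fin M × Fin M → Bool → ℝ) :
    ∫ ω, F (a l ω) (y l ω) ∂P
      = ∑ q, p q * (Real.sigmoid (inner ℝ βstar (design q (x l))) * F q true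
          + (1 - Real.sigmoid (inner ℝ βstar (design q (x l)))) * F q false) := by
  rw [h.integral_comp_sample]
  refine Finset.sum_congr rfl fun q _ => ?_
  rcases (h.prob_nonneg q).lt_or_eq with hq | hq
  · rw [h.inner_eq_of_isTrueParam htrue l hq]
  · rw [← hq, zero_mul, zero_mul]

lemma IsBTLSample.integral_inner_score (h : IsBTLSample P p b x a y) {βstar : Param M d}
    (htrue : IsTrueParam P x a y βstar) (l : ℕ) (u : Param M d) :
    ∫ ω, inner ℝ (score βstar (a l ω) (x l) (y l ω)) u ∂P = 0 := by
  rw [h.integral_comp_sample' htrue l fun q o => inner ℝ (score βstar q (x l) o) u]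
  refine Finset.sum_eq_zero fun q _ => ?_
  simp only [score, real_inner_smul_left, outcome, if_true, Bool.false_eq_true, if_false]
  ring

lemma fisherInfo_quadratic (L : ℕ) (β u : Param M d) :
    u.ofLp ⬝ᵥ fisherInfo L p x β *ᵥ u.ofLp
      = ∑ l ∈ Finset.range L, ∑ q,
          p q * logisticVar (inner ℝ β (design q (x l))) * inner ℝ u (design q (x l)) ^ 2 := by
  rw [fisherInfo, Matrix.sum_mulVec, dotProduct_sum]
  refine Finset.sum_congr rfl fun l _ => ?_
  rw [Matrix.sum_mulVec, dotProduct_sum]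
  refine Finset.sum_congr rfl fun q _ => ?_
  rw [Matrix.smul_mulVec, dotProduct_smul, vecMulVec_quadratic, inner_eq_dotProduct u,
    smul_eq_mul, logisticVar]

/-- Information identity: given the pair, `σ (1 - σ)² + (1 - σ) σ² = σ (1 - σ)`. -/
lemma IsBTLSample.sum_integral_inner_score_sq (h : IsBTLSample P p b x a y) {βstar : Param M d}
    (htrue : IsTrueParam P x a y βstar) (L : ℕ) (u : Param M d) :
    ∑ l ∈ Finset.range L, ∫ ω, inner ℝ (score βstar (a l ω) (x l) (y l ω)) u ^ 2 ∂P
      = u.ofLp ⬝ᵥ fisherInfo L p x βstar *ᵥ u.ofLp := by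
  rw [fisherInfo_quadratic]
  refine Finset.sum_congr rfl fun l _ => ?_
  rw [h.integral_comp_sample' htrue l fun q o => inner ℝ (score βstar q (x l) o) u ^ 2]
  refine Finset.sum_congr rfl fun q _ => ?_
  simp only [score, real_inner_smul_left, outcome, if_true, Bool.false_eq_true, if_false,
    logisticVar, real_inner_comm (design q (x l)) u]
  ring

lemma IsBTLSample.sum_integral_hessian (h : IsBTLSample P p b x a y) (βstar : Param M d)
    (htrue : IsTrueParam P x a y βstar) (L : ℕ) (c c' : Coord M d) :
    ∑ l ∈ Finset.range L, ∫ ω, hessian βstar (a l ω) (x l) c c' ∂P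
      = fisherInfo L p x βstar c c' := by
  rw [fisherInfo, Matrix.sum_apply]
  refine Finset.sum_congr rfl fun l _ => ?_
  rw [h.integral_comp_sample' htrue l fun q _ => hessian βstar q (x l) c c', Matrix.sum_apply]
  refine Finset.sum_congr rfl fun q _ => ?_
  simp only [hessian, Matrix.smul_apply, smul_eq_mul, logisticVar]
  ring

lemma transpose_fisherInfo (L : ℕ) (β : Param M d) :
    (fisherInfo L p x β)ᵀ = fisherInfo L p x β := by
  simp [fisherInfo, Matrix.transpose_sum, Matrix.transpose_vecMulVec]

lemma constraintMatrix_mul_fisherInfo (L : ℕ) (β : Param M d) :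
    constraintMatrix M d * fisherInfo L p x β = 0 := by
  rw [fisherInfo, Matrix.mul_sum]
  refine Finset.sum_eq_zero fun l _ => ?_
  rw [Matrix.mul_sum]
  refine Finset.sum_eq_zero fun q _ => ?_
  rw [Matrix.mul_smul, Matrix.mul_vecMulVec, (mem_Theta_iff _).1 (design_mem_Theta q (x l))]
  simp

lemma FisherLimit.transpose_eq {β : Param M d} {A : Matrix (Coord M d) (Coord M d) ℝ}
    (h : FisherLimit p x β A) : Aᵀ = A := by
  have h1 : Tendsto (fun L : ℕ => ((L : ℝ)⁻¹ • fisherInfo L p x β)ᵀ) atTop (𝓝 Aᵀ) :=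
    (continuous_id.matrix_transpose.tendsto A).comp h.1
  simp_rw [Matrix.transpose_smul, transpose_fisherInfo] at h1
  exact tendsto_nhds_unique h1 h.1

/-- Every summand has its range spanned by a design vector, which lies in `Θ`, and the equation
passes to the limit. -/
lemma FisherLimit.constraintMatrix_mul {β : Param M d} {A : Matrix (Coord M d) (Coord M d) ℝ}
    (h : FisherLimit p x β A) : constraintMatrix M d * A = 0 := by
  have h1 : Tendsto (fun L : ℕ => constraintMatrix M d * ((L : ℝ)⁻¹ • fisherInfo L p x β)) atTop
      (𝓝 (constraintMatrix M d * A)) :=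
    ((continuous_const.matrix_mul continuous_id).tendsto A).comp h.1
  simp_rw [Matrix.mul_smul, constraintMatrix_mul_fisherInfo, smul_zero] at h1
  exact tendsto_nhds_unique h1 tendsto_const_nhds

lemma FisherLimit.tendsto_quadratic {β : Param M d} {A : Matrix (Coord M d) (Coord M d) ℝ}
    (h : FisherLimit p x β A) (u : Coord M d → ℝ) :
    Tendsto (fun L : ℕ => (L : ℝ)⁻¹ * (u ⬝ᵥ fisherInfo L p x β *ᵥ u)) atTop
      (𝓝 (u ⬝ᵥ A *ᵥ u)) := by
  have hc : Continuous fun B : Matrix (Coord M d) (Coord M d) ℝ => u ⬝ᵥ B *ᵥ u :=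
    continuous_const.dotProduct (continuous_id.matrix_mulVec continuous_const)
  have := (hc.tendsto A).comp h.1
  simpa [Function.comp_def, Matrix.smul_mulVec] using this

/-! ### Stochastic bounds for the score and the Hessian -/

lemma norm_score_le (β : Param M d) (q : Fin M × Fin M) (x : EuclideanSpace ℝ (Fin d))
    (y : Bool) : ‖score β q x y‖ ≤ ‖(design q x : Param M d)‖ := by
  rw [score, norm_smul]
  refine mul_le_of_le_one_left (norm_nonneg _) ?_
  have h1 := Real.sigmoid_nonneg (inner ℝ β (design q x))
  have h2 := Real.sigmoid_le_one (inner ℝ β (design q x))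
  rw [Real.norm_eq_abs, abs_le]
  cases y <;> simp [outcome] <;> constructor <;> linarith

lemma abs_hessian_apply_le (β : Param M d) (q : Fin M × Fin M) (x : EuclideanSpace ℝ (Fin d))
    (c c' : Coord M d) : |hessian β q x c c'| ≤ ‖(design q x : Param M d)‖ ^ 2 := by
  simp only [hessian, Matrix.smul_apply, Matrix.vecMulVec_apply, smul_eq_mul, abs_mul]
  rw [abs_of_nonneg (logisticVar_nonneg _), sq]
  refine (mul_le_of_le_one_left (by positivity) (logisticVar_le_one _)).trans ?_
  exact mul_le_mul (abs_apply_le_norm _ _) (abs_apply_le_norm _ _) (abs_nonneg _) (norm_nonneg _)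

lemma norm_le_sqrt_card_mul {ι : Type*} [Fintype ι] {v : EuclideanSpace ℝ ι} {K : ℝ} (hK : 0 ≤ K)
    (hv : ∀ c, |v c| ≤ K) : ‖v‖ ≤ √(Fintype.card ι : ℝ) * K := by
  rw [EuclideanSpace.norm_eq]
  refine Real.sqrt_le_iff.2 ⟨by positivity, ?_⟩
  rw [mul_pow, Real.sq_sqrt (by positivity)]
  calc _ ≤ ∑ _ : ι, K ^ 2 := Finset.sum_le_sum fun c _ => by
        rw [Real.norm_eq_abs]
        exact pow_le_pow_left₀ (abs_nonneg _) (hv c) 2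
    _ = _ := by simp

end

/-! ### Asymptotic linearity of the estimator -/

/-- The continuous linear map of a matrix between Euclidean spaces. -/
def euclideanMap {m n : Type*} [Fintype m] [Fintype n] [DecidableEq n] (A : Matrix m n ℝ) :
    EuclideanSpace ℝ n →L[ℝ] EuclideanSpace ℝ m :=
  LinearMap.toContinuousLinearMap (Matrix.toEuclideanLin A)

lemma euclideanMap_apply {m n : Type*} [Fintype m] [Fintype n] [DecidableEq n]
    (A : Matrix m n ℝ) (v : EuclideanSpace ℝ n) :
    euclideanMap A v = WithLp.toLp 2 (A *ᵥ v.ofLp) := rfl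

section

variable {M d : ℕ}

/-- The score of the first `L` comparisons divided by `√L`. -/
def normalizedScore (L : ℕ) (x : ℕ → EuclideanSpace ℝ (Fin d)) (a : ℕ → Fin M × Fin M)
    (y : ℕ → Bool) (β : Param M d) : Param M d :=
  (√(L : ℝ))⁻¹ • ∑ l ∈ Finset.range L, score β (a l) (x l) (y l)

lemma normalizedScore_mem_Theta (L : ℕ) (x : ℕ → EuclideanSpace ℝ (Fin d))
    (a : ℕ → Fin M × Fin M) (y : ℕ → Bool) (β : Param M d) :
    normalizedScore L x a y β ∈ Theta M d :=
  (thetaSubmodule M d).smul_mem _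
    ((thetaSubmodule M d).sum_mem fun l _ => score_mem_Theta β (a l) (x l) (y l))

variable {Ω : Type*} [MeasurableSpace Ω] {P : Measure Ω} [IsProbabilityMeasure P]
  {p : Fin M × Fin M → ℝ} {b : Param M d} {x : ℕ → EuclideanSpace ℝ (Fin d)}
  {a : ℕ → Ω → Fin M × Fin M} {y : ℕ → Ω → Bool}

/-- Tightness of the normalized score: the Chebyshev bound does not depend on `L`. -/
lemma IsBTLSample.measureReal_score_ge_le (h : IsBTLSample P p b x a y) {βstar : Param M d}
    (htrue : IsTrueParam P x a y βstar) {B : ℝ}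
    (hB : ∀ᵐ ω ∂P, ∀ l, ‖(design (a l ω) (x l) : Param M d)‖ ≤ B) (c : Coord M d) {L : ℕ}
    (hL : 0 < L) {K : ℝ} (hK : 0 < K) :
    P.real {ω | K ≤ |normalizedScore L x (fun l => a l ω) (fun l => y l ω) βstar c|}
      ≤ B ^ 2 / K ^ 2 := by
  classical
  have hr0 : 0 < √(L : ℝ) := Real.sqrt_pos.2 (by exact_mod_cast hL)
  have hr2 : √(L : ℝ) ^ 2 = L := Real.sq_sqrt (Nat.cast_nonneg L)
  have hch := measure_abs_sum_sub_integral_ge_le (P := P)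
    (ξ := fun l ω => score βstar (a l ω) (x l) (y l ω) c) (C := B)
    (fun l => (h.measurable_comp_sample l fun q o => score βstar q (x l) o c).aemeasurable)
    (h.iIndepFun_comp_sample fun l q o => score βstar q (x l) o c)
    (fun l => by
      filter_upwards [hB] with ω hω
      exact (abs_apply_le_norm _ _).trans ((norm_score_le _ _ _ _).trans (hω l)))
    L (mul_pos hr0 hK)
  have h0 : ∀ l, ∫ ω, score βstar (a l ω) (x l) (y l ω) c ∂P = 0 := fun l => by
    have := h.integral_inner_score htrue l (EuclideanSpace.single c 1)
    simp_rw [inner_eq_dotProduct] at this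
    simpa using this
  simp only [h0, Finset.sum_const_zero, sub_zero] at hch
  refine (ENNReal.toReal_le_of_le_ofReal (by positivity) ?_)
  refine le_trans (le_of_eq ?_) (hch.trans (le_of_eq ?_))
  · congr 1
    ext ω
    simp only [Set.mem_ofPred_eq, normalizedScore, PiLp.smul_apply, smul_eq_mul, abs_mul, abs_inv,
      abs_of_pos hr0, WithLp.ofLp_sum, Finset.sum_apply]
    rw [le_inv_mul_iff₀ hr0]
  · congr 1
    rw [mul_pow, hr2]
    have : (0 : ℝ) < L := by exact_mod_cast hL
    field_simp

lemma IsBTLSample.measureReal_hessian_ge_le (h : IsBTLSample P p b x a y) {βstar : Param M d}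
    (htrue : IsTrueParam P x a y βstar) {B : ℝ}
    (hB : ∀ᵐ ω ∂P, ∀ l, ‖(design (a l ω) (x l) : Param M d)‖ ≤ B) (c c' : Coord M d) {L : ℕ}
    (hL : 0 < L) {ε : ℝ} (hε : 0 < ε) :
    P.real {ω | ε ≤ |((L : ℝ)⁻¹ • ∑ l ∈ Finset.range L, hessian βstar (a l ω) (x l)
        - (L : ℝ)⁻¹ • fisherInfo L p x βstar) c c'|}
      ≤ B ^ 4 / ε ^ 2 * (L : ℝ)⁻¹ := by
  have hL0 : (0 : ℝ) < L := by exact_mod_cast hL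
  have hch := measure_abs_sum_sub_integral_ge_le (P := P)
    (ξ := fun l ω => hessian βstar (a l ω) (x l) c c') (C := B ^ 2)
    (fun l => (h.measurable_comp_sample l fun q _ => hessian βstar q (x l) c c').aemeasurable)
    (h.iIndepFun_comp_sample fun l q _ => hessian βstar q (x l) c c')
    (fun l => by
      filter_upwards [hB] with ω hω
      exact (abs_hessian_apply_le _ _ _ _ _).trans
        (pow_le_pow_left₀ (norm_nonneg _) (hω l) 2))
    L (mul_pos hL0 hε)
  rw [h.sum_integral_hessian βstar htrue] at hch
  refine (ENNReal.toReal_le_of_le_ofReal (by positivity) ?_)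
  refine le_trans (le_of_eq ?_) (hch.trans (le_of_eq ?_))
  · congr 1
    ext ω
    simp only [Set.mem_ofPred_eq, Matrix.smul_apply, Matrix.sub_apply, Matrix.sum_apply,
      smul_eq_mul, ← mul_sub, abs_mul, abs_inv, abs_of_pos hL0]
    rw [le_inv_mul_iff₀ hL0]
  · congr 1
    field_simp

/-- The constrained maximum likelihood estimator is asymptotically linear in the score. -/
theorem IsConstrainedMLE.tendsto_measureReal (h : IsBTLSample P p b x a y) {βstar : Param M d}
    (htrue : IsTrueParam P x a y βstar) {βhat : ℕ → Ω → Param M d}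
    (hmle : IsConstrainedMLE P x a y βhat) (hbdd : Boundedness p x βstar)
    {A : Matrix (Coord M d) (Coord M d) ℝ} (hfisher : FisherLimit p x βstar A) {δ : ℝ}
    (hδ : 0 < δ) :
    Tendsto (fun L : ℕ => P.real {ω | δ < ‖√(L : ℝ) • (βhat L ω - βstar)
      - euclideanMap (pinv A) (normalizedScore L x (fun l => a l ω) (fun l => y l ω) βstar)‖})
      atTop (𝓝 0) := by
  obtain ⟨B, hB⟩ := hbdd.1
  have hBae : ∀ᵐ ω ∂P, ∀ l, ‖(design (a l ω) (x l) : Param M d)‖ ≤ B := by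
    filter_upwards [h.ae_pos] with ω hω l
    exact (hB l _ (hω l)).le
  have hβ : βstar ∈ Theta M d := (htrue 0).1
  have hsymm := hfisher.transpose_eq
  have hCA := hfisher.constraintMatrix_mul
  obtain ⟨m, hm0, hm⟩ := exists_quadratic_lower_bound hfisher.2
  set N : ℝ := (Fintype.card (Coord M d) : ℝ) with hN
  have hN0 : 0 ≤ N := Nat.cast_nonneg _
  have hsq : Tendsto (fun L : ℕ => (√(L : ℝ))⁻¹) atTop (𝓝 0) :=
    tendsto_inv_atTop_zero.comp (Real.tendsto_sqrt_atTop.comp tendsto_natCast_atTop_atTop)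
  rw [tendsto_order]
  refine ⟨fun η hη => Eventually.of_forall fun L => hη.trans_le measureReal_nonneg,
    fun η hη => ?_⟩
  -- The failure probability `η` is split evenly: half for a large score, half for a Hessian far
  -- from its mean. On the event where all coordinates of the score are below `K`, the radius `R`
  -- defined next bounds `A† W`.
  obtain ⟨K, hK0, hK⟩ : ∃ K > 0, N * (B ^ 2 / K ^ 2) < η / 2 := by
    have : Tendsto (fun K : ℝ => N * (B ^ 2 / K ^ 2)) atTop (𝓝 0) := by
      simpa using ((tendsto_const_nhds (x := B ^ 2)).div_atTop
        (tendsto_pow_atTop (n := 2) (by norm_num))).const_mul N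
    exact ((eventually_gt_atTop 0).and (this.eventually_lt_const (half_pos hη))).exists
  set R : ℝ := ‖euclideanMap (pinv A)‖ * (√N * K) with hR
  -- One `ε` is for the random fluctuation of the Hessian, the other for the deterministic
  -- convergence of the Fisher information. The margin `m δ² / 4` is shared equally with the cubic
  -- remainder.
  obtain ⟨ε, hε0, hε⟩ : ∃ ε > 0, N ^ 2 * (ε + ε) * (R + δ) ^ 2 / 2 < m * δ ^ 2 / 8 := by
    have hc : Tendsto (fun ε : ℝ => N ^ 2 * (ε + ε) * (R + δ) ^ 2 / 2) (𝓝[>] 0) (𝓝 0) := by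
      have : Continuous fun ε : ℝ => N ^ 2 * (ε + ε) * (R + δ) ^ 2 / 2 := by fun_prop
      simpa using (this.tendsto 0).mono_left nhdsWithin_le_nhds
    exact (eventually_mem_nhdsWithin.and (hc.eventually_lt_const (by positivity))).exists
  have hev1 : ∀ᶠ L : ℕ in atTop, (B * (R + δ)) ^ 3 * (√(L : ℝ))⁻¹ < m * δ ^ 2 / 8 := by
    have : Tendsto (fun L : ℕ => (B * (R + δ)) ^ 3 * (√(L : ℝ))⁻¹) atTop (𝓝 0) := by
      simpa using hsq.const_mul ((B * (R + δ)) ^ 3)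
    exact this.eventually_lt_const (by positivity)
  have hev2 : ∀ᶠ L : ℕ in atTop, ∀ c c', |((L : ℝ)⁻¹ • fisherInfo L p x βstar - A) c c'| ≤ ε := by
    rw [eventually_all]
    intro c
    rw [eventually_all]
    intro c'
    have h1 : Tendsto (fun L : ℕ => |((L : ℝ)⁻¹ • fisherInfo L p x βstar - A) c c'|) atTop
        (𝓝 |(A - A) c c'|) :=
      ((continuous_id.matrix_elem c c').tendsto (A - A)).comp (hfisher.1.sub_const A) |>.abs
    rw [sub_self, Matrix.zero_apply, abs_zero] at h1
    exact h1.eventually_le_const hε0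
  have hev3 : ∀ᶠ L : ℕ in atTop, N ^ 2 * (B ^ 4 / ε ^ 2 * (L : ℝ)⁻¹) < η / 2 := by
    have : Tendsto (fun L : ℕ => N ^ 2 * (B ^ 4 / ε ^ 2 * (L : ℝ)⁻¹)) atTop (𝓝 0) := by
      simpa using ((tendsto_inv_atTop_nhds_zero_nat (𝕜 := ℝ)).const_mul
        (B ^ 4 / ε ^ 2)).const_mul (N ^ 2)
    exact this.eventually_lt_const (half_pos hη)
  filter_upwards [hev1, hev2, hev3, eventually_gt_atTop 0] with L h1 h2 h3 hL
  set S : Coord M d → Set Ω := fun c =>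
    {ω | K ≤ |normalizedScore L x (fun l => a l ω) (fun l => y l ω) βstar c|} with hS
  set T : Coord M d × Coord M d → Set Ω := fun c =>
    {ω | ε ≤ |((L : ℝ)⁻¹ • ∑ l ∈ Finset.range L, hessian βstar (a l ω) (x l)
        - (L : ℝ)⁻¹ • fisherInfo L p x βstar) c.1 c.2|} with hT
  have hsub : {ω | δ < ‖√(L : ℝ) • (βhat L ω - βstar)
      - euclideanMap (pinv A) (normalizedScore L x (fun l => a l ω) (fun l => y l ω) βstar)‖}
      ≤ᵐ[P] ((⋃ c, S c) ∪ ⋃ c, T c : Set Ω) := by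
    filter_upwards [hBae, (hmle L).2] with ω hω hmleω hbad
    by_contra hgood
    change ¬ (ω ∈ (⋃ c, S c) ∪ ⋃ c, T c) at hgood
    simp only [Set.mem_union, Set.mem_iUnion, not_or, not_exists, hS, hT, Set.mem_ofPred_eq,
      not_le] at hgood
    set W := normalizedScore L x (fun l => a l ω) (fun l => y l ω) βstar with hW
    have hWn : ‖W‖ ≤ √N * K := norm_le_sqrt_card_mul hK0.le fun c => (hgood.1 c).le
    have hWT : W ∈ Theta M d := normalizedScore_mem_Theta _ _ _ _ _
    have hg : ‖euclideanMap (pinv A) W‖ ≤ R :=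
      ((euclideanMap (pinv A)).le_opNorm W).trans
        (mul_le_mul_of_nonneg_left hWn (norm_nonneg _))
    have key := exists_thetaArgmin_and_forall_norm_sub_le hL x (fun l => a l ω) (fun l => y l ω)
      hβ hω hsymm hm (ε := ε + ε) (fun c c' => by
        have e : (L : ℝ)⁻¹ • ∑ l ∈ Finset.range L, hessian βstar (a l ω) (x l) - A
            = ((L : ℝ)⁻¹ • ∑ l ∈ Finset.range L, hessian βstar (a l ω) (x l)
              - (L : ℝ)⁻¹ • fisherInfo L p x βstar)
              + ((L : ℝ)⁻¹ • fisherInfo L p x βstar - A) := by abel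
        rw [e, Matrix.add_apply]
        exact (abs_add_le _ _).trans (add_le_add (hgood.2 (c, c')).le (h2 c c')))
      (g := euclideanMap (pinv A) W) (toLp_pinv_mulVec_mem_Theta hsymm hCA _)
      (mulVec_pinv_mulVec hsymm hCA hfisher.2 hWT) hg hδ (by linarith)
    -- On the good event a minimizer exists, so `βhat` is one; its arbitrary values elsewhere are
    -- absorbed in the exceptional probability.
    exact absurd (key.2 _ (hmleω key.1)) (not_le.2 hbad)
  calc _ ≤ P.real ((⋃ c, S c) ∪ ⋃ c, T c) :=
        ENNReal.toReal_mono (measure_ne_top _ _) (measure_mono_ae hsub)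
    _ ≤ P.real (⋃ c, S c) + P.real (⋃ c, T c) := measureReal_union_le _ _
    _ ≤ ∑ c, P.real (S c) + ∑ c, P.real (T c) :=
        add_le_add (measureReal_iUnion_fintype_le _) (measureReal_iUnion_fintype_le _)
    _ ≤ ∑ _c : Coord M d, B ^ 2 / K ^ 2
        + ∑ _c : Coord M d × Coord M d, B ^ 4 / ε ^ 2 * (L : ℝ)⁻¹ :=
        add_le_add
          (Finset.sum_le_sum fun c _ => h.measureReal_score_ge_le htrue hBae c hL hK0)
          (Finset.sum_le_sum fun c _ => h.measureReal_hessian_ge_le htrue hBae c.1 c.2 hL hε0)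
    _ = N * (B ^ 2 / K ^ 2) + N ^ 2 * (B ^ 4 / ε ^ 2 * (L : ℝ)⁻¹) := by
        simp only [Finset.sum_const, Finset.card_univ, nsmul_eq_mul, Fintype.card_prod,
          Nat.cast_mul, ← hN]
        ring
    _ < η := by linarith

lemma FisherLimit.posSemidef {β : Param M d} (hp : ∀ q, 0 ≤ p q)
    {A : Matrix (Coord M d) (Coord M d) ℝ} (h : FisherLimit p x β A) : A.PosSemidef := by
  refine Matrix.PosSemidef.of_dotProduct_mulVec_nonneg ?_ fun u => ?_
  · rw [Matrix.IsHermitian, Matrix.conjTranspose_eq_transpose_of_trivial, h.transpose_eq]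
  · rw [star_trivial]
    refine ge_of_tendsto' (h.tendsto_quadratic u) fun L => ?_
    have := fisherInfo_quadratic (p := p) (x := x) L β (WithLp.toLp 2 u)
    simp only at this
    rw [this]
    refine mul_nonneg (by positivity) (Finset.sum_nonneg fun l _ => Finset.sum_nonneg fun q _ => ?_)
    exact mul_nonneg (mul_nonneg (hp q) (logisticVar_nonneg _)) (sq_nonneg _)

/-- Inserting `A† = A† A A†` turns the claimed covariance into that of a linear image of a vector
with covariance `A`. -/
lemma mul_pinv_mul_transpose_eq {m n : Type*} [Fintype m] [Fintype n] {A : Matrix n n ℝ}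
    (hsymm : Aᵀ = A) (X : Matrix m n ℝ) :
    X * pinv A * Xᵀ = (pinv A * Xᵀ)ᵀ * A * (pinv A * Xᵀ) := by
  rw [Matrix.transpose_mul, Matrix.transpose_transpose, transpose_pinv hsymm]
  conv_lhs => rw [← (isMoorePenrose_pinv A).self_mul_mul]
  simp only [Matrix.mul_assoc]

/-- Asymptotic normality of linear images of the normalized score. -/
lemma IsBTLSample.tendstoInDistribution_score {m : Type*} [Fintype m] [DecidableEq m]
    (h : IsBTLSample P p b x a y) {βstar : Param M d} (htrue : IsTrueParam P x a y βstar)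
    (hbdd : Boundedness p x βstar) {A : Matrix (Coord M d) (Coord M d) ℝ}
    (hfisher : FisherLimit p x βstar A) (Y : Matrix m (Coord M d) ℝ)
    (hY : (Y * A * Yᵀ).PosSemidef) :
    TendstoInDistribution (fun (L : ℕ) ω => euclideanMap Y
      (normalizedScore L x (fun l => a l ω) (fun l => y l ω) βstar)) atTop
      (id : EuclideanSpace ℝ m → EuclideanSpace ℝ m) (fun _ => P)
      (multivariateGaussian 0 (Y * A * Yᵀ)) := by
  obtain ⟨B, hB⟩ := hbdd.1
  have hinner : ∀ (w : Param M d) (t : EuclideanSpace ℝ m),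
      inner ℝ (euclideanMap Y w) t = inner ℝ w (euclideanMap Yᵀ t) := by
    intro w t
    rw [inner_eq_dotProduct, inner_eq_dotProduct, euclideanMap_apply, euclideanMap_apply]
    change Y *ᵥ w.ofLp ⬝ᵥ t.ofLp = w.ofLp ⬝ᵥ Yᵀ *ᵥ t.ofLp
    rw [Matrix.mulVec_transpose, dotProduct_comm, Matrix.dotProduct_mulVec, dotProduct_comm]
  have hquad : ∀ t : EuclideanSpace ℝ m, (euclideanMap Yᵀ t).ofLp ⬝ᵥ A *ᵥ (euclideanMap Yᵀ t).ofLp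
      = t.ofLp ⬝ᵥ (Y * A * Yᵀ) *ᵥ t.ofLp := by
    intro t
    change (Yᵀ *ᵥ t.ofLp) ⬝ᵥ A *ᵥ (Yᵀ *ᵥ t.ofLp) = _
    rw [Matrix.mulVec_mulVec, Matrix.mulVec_transpose, ← Matrix.dotProduct_mulVec,
      Matrix.mulVec_mulVec, Matrix.mul_assoc]
  have hclt := tendstoInDistribution_normalized_sum (P := P)
    (ξ := fun l ω => euclideanMap Y (score βstar (a l ω) (x l) (y l ω)))
    (fun l => h.measurable_comp_sample l fun q o => euclideanMap Y (score βstar q (x l) o))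
    (h.iIndepFun_comp_sample fun l q o => euclideanMap Y (score βstar q (x l) o))
    (C := ‖euclideanMap Y‖ * B)
    (fun l => by
      filter_upwards [h.ae_pos] with ω hω
      exact ((euclideanMap Y).le_opNorm _).trans (mul_le_mul_of_nonneg_left
        ((norm_score_le _ _ _ _).trans (hB l _ (hω l)).le) (norm_nonneg _)))
    (fun l t => by
      simp_rw [hinner]
      exact h.integral_inner_score htrue l _)
    (v := fun t => t.ofLp ⬝ᵥ (Y * A * Yᵀ) *ᵥ t.ofLp)
    (fun t => by
      simp_rw [hinner, h.sum_integral_inner_score_sq htrue, ← hquad]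
      exact hfisher.tendsto_quadratic _)
    (multivariateGaussian 0 (Y * A * Yᵀ))
    (fun t => by
      rw [charFun_multivariateGaussian hY, inner_zero_right]
      simp)
  simpa only [normalizedScore, map_smul, map_sum] using hclt

end

end ContextualBTL

end

/-! ### Transfer to utility differences at a fixed prompt -/

theorem corollary1 {M d : ℕ} {Ω : Type*} [MeasurableSpace Ω]
    (P : Measure Ω) [IsProbabilityMeasure P]
    (p : Fin M × Fin M → ℝ) (b : ContextualBTL.Param M d)
    (x : ℕ → EuclideanSpace ℝ (Fin d))
    (a : ℕ → Ω → Fin M × Fin M) (y : ℕ → Ω → Bool)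
    (hsample : ContextualBTL.IsBTLSample P p b x a y)
    (βstar : ContextualBTL.Param M d)
    (htrue : ContextualBTL.IsTrueParam P x a y βstar)
    (βhat : ℕ → Ω → ContextualBTL.Param M d)
    (hmle : ContextualBTL.IsConstrainedMLE P x a y βhat)
    (hconn : (ContextualBTL.comparisonGraph p).Connected)
    (hrich : ContextualBTL.CovariateRichness P x a)
    (hbdd : ContextualBTL.Boundedness p x βstar)
    (Ibar : Matrix (ContextualBTL.Coord M d) (ContextualBTL.Coord M d) ℝ)
    (hfisher : ContextualBTL.FisherLimit p x βstar Ibar)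
    (S : Finset (Fin M × Fin M)) (x₀ : EuclideanSpace ℝ (Fin d)) :
    (ContextualBTL.designMatrix S x₀ *
        ContextualBTL.pinv (ContextualBTL.proj M d * Ibar * ContextualBTL.proj M d) *
        (ContextualBTL.designMatrix S x₀)ᵀ).PosSemidef ∧
      TendstoInDistribution
        (fun (L : ℕ) (ω : Ω) => √(L : ℝ) •
          (ContextualBTL.utilityDiff S x₀ (βhat L ω) - ContextualBTL.utilityDiff S x₀ βstar))
        atTop (id : EuclideanSpace ℝ S → EuclideanSpace ℝ S) (fun _ => P)
        (multivariateGaussian 0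
          (ContextualBTL.designMatrix S x₀ *
            ContextualBTL.pinv (ContextualBTL.proj M d * Ibar * ContextualBTL.proj M d) *
            (ContextualBTL.designMatrix S x₀)ᵀ)) := by
  have hsymm := hfisher.transpose_eq
  have hCA := hfisher.constraintMatrix_mul
  rw [ContextualBTL.proj_mul_mul_proj hsymm hCA]
  set X := ContextualBTL.designMatrix S x₀ with hX
  set G := ContextualBTL.pinv Ibar with hG
  have hGt : Gᵀ = G := ContextualBTL.transpose_pinv hsymm
  have hcov : X * G * Xᵀ = X * G * Ibar * (X * G)ᵀ := by
    rw [ContextualBTL.mul_pinv_mul_transpose_eq hsymm X]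
    simp only [Matrix.transpose_mul, Matrix.transpose_transpose, ← hG, hGt]
  have hpsd : (X * G * Ibar * (X * G)ᵀ).PosSemidef := by
    have := (hfisher.posSemidef hsample.prob_nonneg).mul_mul_conjTranspose_same (X * G)
    rwa [Matrix.conjTranspose_eq_transpose_of_trivial] at this
  rw [hcov]
  refine ⟨hpsd, ?_⟩
  have hclt := hsample.tendstoInDistribution_score htrue hbdd hfisher (X * G) hpsd
  -- Slutsky: it suffices that the scaled error differs from the image of the score under `X * G` by
  -- a term that tends to zero in probability.
  refine tendstoInDistribution_of_tendstoInMeasure_sub _ _ hclt ?_ fun L => ?_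
  · rw [tendstoInMeasure_iff_measureReal_norm]
    intro ε hε
    set T := ContextualBTL.euclideanMap X with hT
    -- The `+ 1` covers `T = 0` and turns the weak inequality `ε ≤ ‖T v‖` into the strict one `δ <
    -- ‖v‖`.
    have hδ : 0 < ε / (‖T‖ + 1) := by positivity
    refine squeeze_zero (fun _ => measureReal_nonneg) (fun L => ?_)
      (ContextualBTL.IsConstrainedMLE.tendsto_measureReal hsample htrue hmle hbdd hfisher hδ)
    refine measureReal_mono ?_
    intro ω hω
    simp only [Set.mem_ofPred_eq, Pi.sub_apply, Pi.zero_apply, sub_zero] at hω ⊢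
    set W := ContextualBTL.normalizedScore L x (fun l => a l ω) (fun l => y l ω) βstar
    have e : √(L : ℝ) • (ContextualBTL.utilityDiff S x₀ (βhat L ω)
          - ContextualBTL.utilityDiff S x₀ βstar) - ContextualBTL.euclideanMap (X * G) W
        = T (√(L : ℝ) • (βhat L ω - βstar) - ContextualBTL.euclideanMap G W) := by
      have e1 : ContextualBTL.euclideanMap (X * G) W = T (ContextualBTL.euclideanMap G W) := by
        simp only [hT, ContextualBTL.euclideanMap_apply, Matrix.mulVec_mulVec]
      rw [e1, map_sub, map_smul, map_sub]
      rfl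
    rw [e] at hω
    rw [div_lt_iff₀ (by positivity)]
    by_contra hcon
    rw [not_lt] at hcon
    have hle := hω.trans (T.le_opNorm _)
    set n := ‖√(L : ℝ) • (βhat L ω - βstar) - ContextualBTL.euclideanMap G W‖
    have hn : n ≤ 0 := by linarith
    have : ‖T‖ * n ≤ 0 := mul_nonpos_of_nonneg_of_nonpos (norm_nonneg _) hn
    linarith
  · have hm : AEMeasurable (fun ω => ContextualBTL.utilityDiff S x₀ (βhat L ω)) P :=
      (ContextualBTL.euclideanMap X).measurable.comp_aemeasurable (hmle L).1
    exact (hm.sub_const _).const_smul √(L : ℝ)
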